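/- Let $H$ be a real Hilbert space, $T>0$, $\rho\in\,]0,+\infty]$ and $\gamma>0$. **The sets.** Let $C\colon[0,T]\rightrightarrows H$ have nonempty closed values with $d_H(C(t),C(s))\le L_C|t-s|$ for all $s,t\in[0,T]$, where $d_H$ is the (extended-valued) Hausdorff distance, and let each $C(t)$ be $\rho$-uniformly prox-regular: $\langle\zeta,x'-x\rangle\le\frac{\|\zeta\|}{2\rho}\|x'-x\|^2$ for all $x,x'\in C(t)$ and all $\zeta$ in the proximal normal cone $N^P(C(t);x)$ (with $\frac1\rho=0$ if $\rho=+\infty$). Let $x_0\in C(0)$. **The perturbation.** Let $F\colon[0,T]\times H\rightrightarrows H$ have nonempty closed convex values and satisfy: - $(\mathcal H_1)$ for every $t\in[0,T]$, $F(t,\cdot)$ is upper semicontinuous from $H$ into $H$ with the weak topology, i.e. $\{x: F(t,x)\cap A\ne\emptyset\}$ is closed for every weakly closed $A\subset H$; - $(\mathcal H_2)$ there is a Lipschitz function $h\colon H\to[0,\infty)$ such that, for a.e. $t\in[0,T]$, $\inf\{\|w\|:w\in F(t,x)\}\le h(x)$ for all $x\in H$; - $(\mathcal H_3)$ there is $f\colon[0,T]\times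 H\to H$ such that $f(\cdot,x)$ is (Bochner) measurable for every $x$ and $f(t,x)\in\operatorname{proj}^{\gamma}_{F(t,x)}(0)$ for all $(t,x)$, where $\operatorname{proj}^{\varepsilon}_S(x):=\{z\in S:\|x-z\|^2<d_S(x)^2+\varepsilon\}$; - there is a nonnegative integrable function $k$ on $[0,T]$ such that $\langle y-y',x-x'\rangle\le k(t)\|x-x'\|^2$ for all $t\in[0,T]$, $x,x'\in H$, $y\in F(t,x)$, $y'\in F(t,x')$. **The problem.** A solution is an absolutely continuous $x\colon[0,T]\to H$ with $x(0)=x_0$ and $\dot x(t)\in-N(C(t);x(t))+F(t,x(t))$ for a.e. $t\in[0,T]$, where $N$ is the Clarke normal cone (empty outside the set). **The algorithm.** For $n\ge1$ put $\mu_n=T/n$ and $t^n_k=k\mu_n$. Let $\varepsilon_n>0$ satisfy $\varepsilon_n/\mu_n^2\to0$, and let $f$ be any selection as in $(\mathcal H_3)$. Let $x^n_0=x_0$ and, for $0\le k<n$, let $x^n_{k+1}$ be any element of $\operatorname{proj}^{\varepsilon_n}_{C(t^n_{k+1})}\bigl(x^n_k+\int_{t^n_k}^{t^n_{k+1}}f(s,x^n_k)\,ds\bigr)$.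 Define $x_n(0)=x_0$ and, for $t\in\,]t^n_k,t^n_{k+1}]$, $$x_n(t)=x^n_k+\frac{t-t^n_k}{\mu_n}\Bigl(x^n_{k+1}-x^n_k-\int_{t^n_k}^{t^n_{k+1}}f(s,x^n_k)\,ds\Bigr)+\int_{t^n_k}^{t}f(s,x^n_k)\,ds .$$ **Theorem.** There is exactly one solution $x$. For every such $(\varepsilon_n)$, and for every choice of the selection $f$ and of the approximate projections, the whole sequence $(x_n)$ converges to $x$ uniformly on $[0,T]$. Moreover, for every such $(\varepsilon_n)$ there is a constant $D\ge0$, independent of $n$, of $t$, of the selection $f$ and of the approximate projections, such that $$\|x_n(t)-x(t)\|^2\le D\Bigl(\sqrt{\varepsilon_n}+\mu_n+\frac{\sqrt{\varepsilon_n}}{\mu_n}\Bigr)\qquad\text{for all } n\ge1,\ t\in[0,T].$$ -/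

import Mathlib

open Set Filter Topology MeasureTheory
open scoped ENNReal NNReal

namespace SweepingProcess

variable {H : Type*} [NormedAddCommGroup H] [InnerProductSpace ℝ H]

/-- The Clarke tangent cone `T(S; x)`, in its sequential form. -/
def clarkeTangentCone (S : Set H) (x : H) : Set H :=
  {h | ∀ (u : ℕ → H) (τ : ℕ → ℝ), (∀ n, u n ∈ S) → Tendsto u atTop (𝓝 x) →
    (∀ n, 0 < τ n) → Tendsto τ atTop (𝓝 0) →
    ∃ w : ℕ → H, Tendsto w atTop (𝓝 h) ∧ ∀ n, u n + τ n • w n ∈ S}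

/-- The Clarke normal cone `N(S; x)`: the negative polar of the Clarke tangent cone if `x ∈ S`,
and the empty set if `x ∉ S`. -/
def clarkeNormalCone (S : Set H) (x : H) : Set H :=
  {v | x ∈ S ∧ ∀ h ∈ clarkeTangentCone S x, inner ℝ v h ≤ 0}

/-- The proximal normal cone `N^P(S; x)`, that is, the proximal subdifferential at `x` of the
indicator function of `S` (which is `0` on `S` and `+∞` elsewhere), written out. -/
def proximalNormalCone (S : Set H) (x : H) : Set H :=
  {ζ | x ∈ S ∧ ∃ σ : ℝ, 0 ≤ σ ∧ ∃ η : ℝ, 0 < η ∧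
    ∀ y ∈ S ∩ Metric.ball x η, inner ℝ ζ (y - x) ≤ σ * ‖y - x‖ ^ 2}

/-- `ρ`-uniform prox-regularity of a closed set, for `ρ ∈ (0, +∞]`; for `ρ = +∞` the factor
`1 / ρ` is `0`. -/
def UniformlyProxRegular (ρ : ℝ≥0∞) (S : Set H) : Prop :=
  IsClosed S ∧ ∀ x ∈ S, ∀ ζ ∈ proximalNormalCone S x, ∀ x' ∈ S,
    inner ℝ ζ (x' - x) ≤ ‖ζ‖ / 2 * (ρ⁻¹).toReal * ‖x' - x‖ ^ 2

/-- The set `proj_S^ε(x)` of approximate projections. -/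
def approxProj (S : Set H) (ε : ℝ) (x : H) : Set H :=
  {z | z ∈ S ∧ ‖x - z‖ ^ 2 < Metric.infDist x S ^ 2 + ε}

/-- Upper semicontinuity of a set-valued map from `H` (norm topology) into `H` with the weak
topology: inverse images of weakly closed sets are closed. -/
def UpperSemicontinuousWeak (G : H → Set H) : Prop :=
  ∀ A : Set H, IsClosed (toWeakSpace ℝ H '' A) → IsClosed {x | (G x ∩ A).Nonempty}

/-- `f` is a selection of `(t, x) ↦ proj_{F(t, x)}^γ(0)` on `[0, T]` such that every `f(·, x)` is
(Lebesgue, in the sense of Bochner) measurable. -/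
def IsMeasurableSelection (T : ℝ) (F : ℝ → H → Set H) (γ : ℝ) (f : ℝ → H → H) : Prop :=
  (∀ t ∈ Icc 0 T, ∀ x, f t x ∈ approxProj (F t x) γ 0) ∧
  ∀ x, AEStronglyMeasurable (fun t => f t x) (volume.restrict (Icc 0 T))

/-- `x : [0, T] → H` is a solution of the perturbed sweeping process
`ẋ(t) ∈ -N(C(t); x(t)) + F(t, x(t))` for a.e. `t ∈ [0, T]`, `x(0) = x₀`: it is absolutely
continuous, satisfies the initial condition, and at almost every `t` it has a derivative that
belongs to the right-hand side. -/
structure IsSolution (T : ℝ) (C : ℝ → Set H) (F : ℝ → H → Set H) (x₀ : H) (x : ℝ → H) :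
    Prop where
  absolutelyContinuous : AbsolutelyContinuousOnInterval x 0 T
  initial : x 0 = x₀
  inclusion : ∀ᵐ t ∂(volume.restrict (Icc 0 T)),
    ∃ v ∈ clarkeNormalCone (C t) (x t), ∃ y ∈ F t (x t), HasDerivAt x (-v + y) t

/-- The time step `μ_n = T / n`. -/
noncomputable def step (T : ℝ) (n : ℕ) : ℝ := T / n

/-- The nodes `t_k^n = k T / n` of the uniform partition of `[0, T]`. -/
noncomputable def node (T : ℝ) (n k : ℕ) : ℝ := k * step T n

/-- `(x_n)_{n ≥ 1}` is generated by the catching-up algorithm with approximate projections, with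
errors `ε_n` and selection `f`; `X n k` is the iterate `x_k^n`, `0 ≤ k ≤ n`. -/
structure IsCatchingUp (T : ℝ) (C : ℝ → Set H) (f : ℝ → H → H) (ε : ℕ → ℝ) (x₀ : H)
    (X : ℕ → ℕ → H) (xs : ℕ → ℝ → H) : Prop where
  iterate_zero : ∀ n, 1 ≤ n → X n 0 = x₀
  iterate_succ : ∀ n, 1 ≤ n → ∀ k < n,
    X n (k + 1) ∈ approxProj (C (node T n (k + 1))) (ε n)
      (X n k + ∫ s in (node T n k)..(node T n (k + 1)), f s (X n k))
  apply_zero : ∀ n, 1 ≤ n → xs n 0 = x₀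
  apply_Ioc : ∀ n, 1 ≤ n → ∀ k < n, ∀ t ∈ Ioc (node T n k) (node T n (k + 1)),
    xs n t = X n k
      + ((t - node T n k) / step T n) •
          (X n (k + 1) - X n k - ∫ s in (node T n k)..(node T n (k + 1)), f s (X n k))
      + ∫ s in (node T n k)..t, f s (X n k)

end SweepingProcess

/-!
Two trajectories of `ẋ = -v + g` with `v` a normal to the moving set `C` and `g` in the
perturbation `F` can be compared through `u = ‖x - y‖ ^ 2`: prox-regularity bounds the contribution
of the normals by `(‖v₁‖ + ‖v₂‖) u / ρ`, the one-sided Lipschitz condition bounds that of the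
perturbation by `2 k u`, and Grönwall's inequality gives `u = 0`. The same computation is stable
under errors. `IsApproxSolution` allows the normal and the perturbation to be evaluated at times and
points that are off by `δ`, and an error of size `η` in the velocity; then `u ≤ K (δ + η)`, where `K`
depends on the trajectories only through integrable bounds for `‖v‖` and `‖g‖`
(`StandingAssumptions.exists_comparison`).
This one estimate gives uniqueness, convergence and the rate.

* A solution is an approximate solution without errors. Its normals are Clarke normals, which for
  prox-regular sets satisfy the quadratic inequality at all points of the set
  (`UniformlyProxRegular.clarkeNormalCone_subset`). They are integrable because `ẋ` is, and because
  every element of `F t x`, not only a small one, has norm at most `h x`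
  (`norm_le_of_oneSidedLipschitz`).
* A run of the algorithm is, for a small time step `μ`, an approximate solution with `δ` of order
  `μ + √ε` and `η` of order `√ε / μ` (`IsCatchingUpRun.exists_hasVelocity`). For this the
  approximate projection is replaced by the exact one, which exists near a prox-regular set and is
  within `√(2 ε)` of it. Nearest points exist for a dense set of centres, by a variational
  principle of Borwein-Preiss type (`exists_nearest_of_near`), and prox-regularity extends this to
  all centres close to the set.
* For existence, runs with finer and finer partitions form a Cauchy sequence, by comparison with
  each other. Their velocities are bounded, hence converge weakly in `L²` along an ultrafilter, and
  almost everywhere the limits lie in the closed convex hulls of the tails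
  (`exists_weak_limit`). Upper semicontinuity of `F` and prox-regularity of `C` then identify the
  limit as a solution (`StandingAssumptions.exists_isSolution_of_hasVelocity`). This route avoids
  differentiating a Lipschitz function with values in `H`.
* The finitely many coarse partitions, to which the comparison does not apply, are covered by a
  bound on all runs that is uniform because `√ε ≤ c μ`.
-/

/-! ### Absolutely continuous functions -/

namespace AbsolutelyContinuousOnInterval

theorem lipschitzOnWith_comp {X Y : Type*} [PseudoMetricSpace X] [PseudoMetricSpace Y]
    {f : ℝ → X} {g : X → Y} {K : ℝ≥0} {s : Set X} {a b : ℝ}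
    (hf : AbsolutelyContinuousOnInterval f a b) (hg : LipschitzOnWith K g s)
    (hs : MapsTo f (uIcc a b) s) :
    AbsolutelyContinuousOnInterval (fun t => g (f t)) a b := by
  unfold AbsolutelyContinuousOnInterval at hf ⊢
  refine squeeze_zero' (Eventually.of_forall fun _ => Finset.sum_nonneg fun _ _ => dist_nonneg) ?_
    (by simpa using hf.const_mul (K : ℝ))
  rw [eventually_inf_principal]
  filter_upwards with E hE
  rw [Finset.mul_sum]
  refine Finset.sum_le_sum fun i hi => ?_
  exact hg.dist_le_mul _ (hs (hE.1 i hi).1) _ (hs (hE.1 i hi).2)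

theorem le_of_ae_hasDerivAt_nonpos {w : ℝ → ℝ} {T : ℝ}
    (hw : AbsolutelyContinuousOnInterval w 0 T)
    (h : ∀ᵐ t ∂(volume.restrict (Icc 0 T)), ∃ w', HasDerivAt w w' t ∧ w' ≤ 0) :
    ∀ t ∈ Icc 0 T, w t ≤ w 0 := by
  intro t ht
  have h1 : AbsolutelyContinuousOnInterval w 0 t := hw.mono (by
    rw [uIcc_of_le ht.1, uIcc_of_le (ht.1.trans ht.2)]; exact Icc_subset_Icc_right ht.2)
  have h2 := h1.integral_deriv_eq_sub
  have h3 : ∫ x in (0 : ℝ)..t, deriv w x ≤ 0 := by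
    rw [intervalIntegral.integral_of_le ht.1]
    refine integral_nonpos_of_ae ?_
    have := ae_restrict_of_ae_restrict_of_subset
      (Ioc_subset_Icc_self.trans (Icc_subset_Icc_right ht.2) : Ioc 0 t ⊆ Icc 0 T) h
    filter_upwards [this] with s hs
    obtain ⟨w', hw', hle⟩ := hs
    simpa [hw'.deriv] using hle
  linarith

/-- Grönwall's inequality for an absolutely continuous function whose derivative satisfies
`u' ≤ A u + B` almost everywhere, with integrable coefficients. -/
theorem gronwall {u A B : ℝ → ℝ} {T : ℝ} (hT : 0 ≤ T)
    (hu : AbsolutelyContinuousOnInterval u 0 T)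
    (hA : IntegrableOn A (Icc 0 T)) (hB : IntegrableOn B (Icc 0 T))
    (hA0 : ∀ t ∈ Icc 0 T, 0 ≤ A t) (hB0 : ∀ t ∈ Icc 0 T, 0 ≤ B t) (hu0 : u 0 ≤ 0)
    (h : ∀ᵐ t ∂(volume.restrict (Icc 0 T)), ∃ u', HasDerivAt u u' t ∧ u' ≤ A t * u t + B t) :
    ∀ t ∈ Icc 0 T, u t ≤ Real.exp (∫ s in (0 : ℝ)..T, A s) * ∫ s in (0 : ℝ)..T, B s := by
  have hA' : IntervalIntegrable A volume 0 T :=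
    (intervalIntegrable_iff_integrableOn_Icc_of_le hT).2 hA
  have hB' : IntervalIntegrable B volume 0 T :=
    (intervalIntegrable_iff_integrableOn_Icc_of_le hT).2 hB
  have hmono : ∀ G : ℝ → ℝ, IntervalIntegrable G volume 0 T → (∀ t ∈ Icc 0 T, 0 ≤ G t) →
      ∀ t ∈ Icc 0 T, (0 ≤ ∫ s in (0 : ℝ)..t, G s) ∧
        (∫ s in (0 : ℝ)..t, G s) ≤ ∫ s in (0 : ℝ)..T, G s := by
    intro G hG hG0 t ht
    have hs1 : IntervalIntegrable G volume 0 t := hG.mono_set (by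
      rw [uIcc_of_le ht.1, uIcc_of_le hT]; exact Icc_subset_Icc_right ht.2)
    have hs2 : IntervalIntegrable G volume t T := hG.mono_set (by
      rw [uIcc_of_le ht.2, uIcc_of_le hT]; exact Icc_subset_Icc_left ht.1)
    have e := intervalIntegral.integral_add_adjacent_intervals hs1 hs2
    have p1 : 0 ≤ ∫ s in (0 : ℝ)..t, G s :=
      intervalIntegral.integral_nonneg ht.1 fun s hs => hG0 s ⟨hs.1, hs.2.trans ht.2⟩
    have p2 : 0 ≤ ∫ s in t..T, G s :=
      intervalIntegral.integral_nonneg ht.2 fun s hs => hG0 s ⟨ht.1.trans hs.1, hs.2⟩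
    exact ⟨p1, by linarith⟩
  have hmA := hmono A hA' hA0
  have hmB := hmono B hB' hB0
  have h0T : (0 : ℝ) ∈ uIcc 0 T := by simp
  have acA := hA'.absolutelyContinuousOnInterval_intervalIntegral h0T
  have acB := hB'.absolutelyContinuousOnInterval_intervalIntegral h0T
  have acE : AbsolutelyContinuousOnInterval
      (fun t => Real.exp (-∫ s in (0 : ℝ)..t, A s)) 0 T := by
    have hl : LipschitzOnWith 1 (fun r : ℝ => Real.exp r) (Iic 0) := by
      refine Convex.lipschitzOnWith_of_nnnorm_deriv_le (fun r _ => Real.differentiableAt_exp) ?_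
        (convex_Iic 0)
      intro r hr
      rw [← NNReal.coe_le_coe]
      simpa [abs_of_pos (Real.exp_pos r)] using hr
    refine acA.fun_neg.lipschitzOnWith_comp hl ?_
    intro t ht
    rw [uIcc_of_le hT] at ht
    simpa using (hmA t ht).1
  -- `u exp (-∫ A) - ∫ B` is nonincreasing, since the exponential is at most `1` and `B ≥ 0`
  have acw := (hu.fun_mul acE).fun_sub acB
  have hw := acw.le_of_ae_hasDerivAt_nonpos (by
    filter_upwards [h, ae_restrict_of_ae hA'.ae_hasDerivAt_integral,
      ae_restrict_of_ae hB'.ae_hasDerivAt_integral, ae_restrict_mem measurableSet_Icc]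
      with t ⟨u', hu', hle⟩ h2 h3 ht
    have ht' : t ∈ uIcc 0 T := by rwa [uIcc_of_le hT]
    have dA := h2 ht' 0 h0T
    have dB := h3 ht' 0 h0T
    refine ⟨_, (hu'.mul dA.neg.exp).sub dB, ?_⟩
    simp only [Pi.neg_apply]
    set e := Real.exp (-∫ s in (0 : ℝ)..t, A s)
    have he0 : 0 < e := Real.exp_pos _
    have he1 : e ≤ 1 := Real.exp_le_one_iff.2 (by linarith [(hmA t ht).1])
    have := mul_le_mul_of_nonneg_right hle he0.le
    have hb := hB0 t ht
    nlinarith)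
  intro t ht
  have := hw t ht
  simp only [intervalIntegral.integral_same, neg_zero, Real.exp_zero, mul_one, sub_zero] at this
  set a := ∫ s in (0 : ℝ)..t, A s
  have e1 : u t = Real.exp a * (u t * Real.exp (-a)) := by
    rw [mul_comm, mul_assoc, ← Real.exp_add]; simp
  have e2 : u t * Real.exp (-a) ≤ ∫ s in (0 : ℝ)..T, B s := by linarith [(hmB t ht).2]
  rw [e1]
  have hBT : 0 ≤ ∫ s in (0 : ℝ)..T, B s := (hmB T ⟨hT, le_rfl⟩).1
  calc Real.exp a * (u t * Real.exp (-a)) ≤ Real.exp a * ∫ s in (0 : ℝ)..T, B s := by gcongr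
    _ ≤ _ := by gcongr; exact (hmA t ht).2

/-- The derivative of an absolutely continuous function with values in a normed space is dominated
by an integrable function, namely by the derivative of the variation function. Differentiability
is not asserted. -/
theorem exists_integrable_bound_deriv {E : Type*} [NormedAddCommGroup E] [NormedSpace ℝ E]
    {y : ℝ → E} {T : ℝ} (hT : 0 ≤ T) (hy : AbsolutelyContinuousOnInterval y 0 T) :
    ∃ m : ℝ → ℝ, IntegrableOn m (Icc 0 T) ∧
      ∀ᵐ t ∂(volume.restrict (Icc 0 T)), ∀ y', HasDerivAt y y' t → ‖y'‖ ≤ m t := by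
  have hbv : LocallyBoundedVariationOn y (Icc 0 T) := by
    have := hy.boundedVariationOn.locallyBoundedVariationOn
    rwa [uIcc_of_le hT] at this
  set V := variationOnFromTo y (Icc 0 T) 0 with hV
  have h0 : (0 : ℝ) ∈ Icc 0 T := ⟨le_rfl, hT⟩
  have hVm : MonotoneOn V (Icc 0 T) := variationOnFromTo.monotoneOn hbv h0
  refine ⟨deriv V, ?_, ?_⟩
  · rw [← intervalIntegrable_iff_integrableOn_Icc_of_le hT]
    exact MonotoneOn.intervalIntegrable_deriv (by rwa [uIcc_of_le hT])
  · have hne : ∀ᵐ t : ℝ, t ≠ 0 ∧ t ≠ T := by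
      have h1 : ∀ᵐ t : ℝ, t ≠ 0 := by simp [ae_iff, measure_singleton]
      have h2 : ∀ᵐ t : ℝ, t ≠ T := by simp [ae_iff, measure_singleton]
      filter_upwards [h1, h2] with t ht1 ht2 using ⟨ht1, ht2⟩
    filter_upwards [ae_restrict_of_ae hVm.ae_differentiableWithinAt_of_mem, ae_restrict_of_ae hne,
      ae_restrict_mem measurableSet_Icc] with t hd hne ht y' hy'
    have hnhds : Icc 0 T ∈ 𝓝 t :=
      Icc_mem_nhds (lt_of_le_of_ne ht.1 hne.1.symm) (lt_of_le_of_ne ht.2 hne.2)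
    have hdV := ((hd ht).differentiableAt hnhds).hasDerivAt
    have s1 := (hasDerivAt_iff_tendsto_slope.1 hy').norm
    have s2 := hasDerivAt_iff_tendsto_slope.1 hdV
    refine le_of_tendsto_of_tendsto s1 s2 ?_
    filter_upwards [mem_nhdsWithin_of_mem_nhds hnhds, self_mem_nhdsWithin] with s hs hst
    have key : ∀ a ∈ Icc 0 T, ∀ b ∈ Icc 0 T, a ≤ b → ‖y b - y a‖ ≤ V b - V a := by
      intro a ha b hb hab
      have e : V b - V a = variationOnFromTo y (Icc 0 T) a b := by
        rw [hV, ← variationOnFromTo.add hbv h0 ha hb]; ring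
      rw [e, variationOnFromTo.eq_of_le _ _ hab, ← dist_eq_norm, dist_edist]
      exact ENNReal.toReal_mono (hbv a b ha hb)
        (eVariationOn.edist_le _ ⟨hb, hab, le_rfl⟩ ⟨ha, le_rfl, hab⟩)
    rw [slope_def_module, slope_def_field, norm_smul, norm_inv, Real.norm_eq_abs, div_eq_inv_mul]
    rcases le_total t s with hts | hts
    · rw [abs_of_nonneg (sub_nonneg.2 hts)]
      exact mul_le_mul_of_nonneg_left (key t ht s hs hts) (inv_nonneg.2 (sub_nonneg.2 hts))
    · rw [abs_of_nonpos (sub_nonpos.2 hts), norm_sub_rev, inv_neg]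
      have hc : (s - t)⁻¹ ≤ 0 := inv_nonpos.2 (sub_nonpos.2 hts)
      nlinarith [mul_le_mul_of_nonneg_left (key s hs t ht hts) (neg_nonneg.2 hc)]

end AbsolutelyContinuousOnInterval

namespace SweepingProcess

/-! ### Nearest points of closed sets -/

theorem approxProj_nonempty {H : Type*} [NormedAddCommGroup H] {S : Set H}
    (hS : S.Nonempty) {ε : ℝ} (hε : 0 < ε) (z : H) :
    (approxProj S ε z).Nonempty := by
  have hd : 0 ≤ Metric.infDist z S := Metric.infDist_nonneg
  have h1 : Metric.infDist z S < √(Metric.infDist z S ^ 2 + ε) :=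
    Real.lt_sqrt_of_sq_lt (by linarith)
  obtain ⟨y, hy, hlt⟩ := (Metric.infDist_lt_iff hS).1 h1
  refine ⟨y, hy, ?_⟩
  rw [dist_eq_norm] at hlt
  have := (Real.lt_sqrt (norm_nonneg _)).1 hlt
  exact this

variable {H : Type*} [NormedAddCommGroup H] [InnerProductSpace ℝ H]

/-- If `y₀` is an approximate nearest point to `z` and the centre is moved from `z` towards `y₀`,
then approximate nearest points to the new centre are close to `y₀`. -/
theorem mul_norm_sub_sq_le_of_approx_nearest {z y₀ y : H} {τ ε ε' : ℝ} (hτ0 : 0 ≤ τ)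
    (hτ1 : τ ≤ 1) (hε : 0 ≤ ε) (h1 : ‖z - y₀‖ ^ 2 ≤ ‖z - y‖ ^ 2 + ε)
    (h2 : ‖z + τ • (y₀ - z) - y‖ ^ 2 ≤ ‖z + τ • (y₀ - z) - y₀‖ ^ 2 + ε') :
    τ * ‖y - y₀‖ ^ 2 ≤ ε + ε' := by
  set a := y - y₀
  set b := z - y₀
  have e1 : z - y = b - a := by simp only [a, b]; abel
  have e2 : z + τ • (y₀ - z) - y = (1 - τ) • b - a := by simp only [a, b]; module
  have e3 : z + τ • (y₀ - z) - y₀ = (1 - τ) • b := by simp only [b]; module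
  rw [e1, norm_sub_sq_real b a] at h1
  rw [e2, e3, norm_sub_sq_real, real_inner_smul_left] at h2
  nlinarith

/-- In a Hilbert space the points that have a nearest point in a given nonempty closed set are
dense. -/
theorem exists_nearest_of_near [CompleteSpace H] {S : Set H} (hS : S.Nonempty)
    (hcl : IsClosed S) (z : H) {δ : ℝ} (hδ : 0 < δ) :
    ∃ z' : H, ‖z' - z‖ ≤ δ ∧ ∃ y ∈ S, ‖z' - y‖ = Metric.infDist z' S := by
  have hch : ∀ (i : ℕ) (w : H), ∃ y ∈ S, ‖w - y‖ ^ 2 < Metric.infDist w S ^ 2 + (1 / 8) ^ i :=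
    fun i w => approxProj_nonempty hS (by positivity) w
  choose p hpS hp using hch
  set M := Metric.infDist z S + δ + 1 with hM
  have hd0 : 0 ≤ Metric.infDist z S := Metric.infDist_nonneg
  have hM0 : 0 < M := by linarith
  set τ : ℕ → ℝ := fun i => δ / M * (1 / 2) ^ (i + 1) with hτ
  have hτpos : ∀ i, 0 < τ i := fun i => by positivity
  have hτ1 : ∀ i, τ i ≤ 1 := by
    intro i
    have h1 : δ / M ≤ 1 := (div_le_one hM0).2 (by linarith)
    have h2 : ((1 : ℝ) / 2) ^ (i + 1) ≤ 1 := pow_le_one₀ (by norm_num) (by norm_num)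
    exact mul_le_one₀ h1 (by positivity) h2
  -- the centres `Z` move towards approximate nearest points by geometrically decreasing amounts;
  -- the weights `τ` decay so slowly, compared with the errors `(1 / 8) ^ i`, that the approximate
  -- nearest points `Y` form a Cauchy sequence as well
  set Z : ℕ → H := fun i => Nat.rec z (fun i w => w + τ i • (p i w - w)) i with hZ
  have hZs : ∀ i, Z (i + 1) = Z i + τ i • (p i (Z i) - Z i) := fun i => rfl
  set Y : ℕ → H := fun i => p i (Z i) with hY
  have hYd : ∀ i w, ‖w - z‖ ≤ δ → ‖w - p i w‖ ≤ M := by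
    intro i w hw
    have h1 : Metric.infDist w S ≤ Metric.infDist z S + δ := by
      have := Metric.infDist_le_infDist_add_dist (s := S) (x := w) (y := z)
      rw [dist_eq_norm] at this; linarith
    have h2 : ((1 : ℝ) / 8) ^ i ≤ 1 := pow_le_one₀ (by norm_num) (by norm_num)
    have h3 : 0 ≤ Metric.infDist w S := Metric.infDist_nonneg
    refine abs_le_of_sq_le_sq' ?_ hM0.le |>.2
    nlinarith [hp i w]
  have hZb : ∀ i, ‖Z i - z‖ ≤ δ * (1 - (1 / 2) ^ i) := by
    intro i
    induction i with
    | zero => simp [hZ]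
    | succ i ih =>
      have h2 : (0 : ℝ) ≤ (1 / 2) ^ i := by positivity
      have h3 := hYd i (Z i) (ih.trans (by nlinarith))
      have e : Z (i + 1) - z = (Z i - z) + τ i • (p i (Z i) - Z i) := by rw [hZs]; abel
      rw [e]
      refine (norm_add_le _ _).trans ?_
      rw [norm_smul, Real.norm_of_nonneg (hτpos i).le, norm_sub_rev (p i (Z i))]
      have h4 : τ i * ‖Z i - p i (Z i)‖ ≤ τ i * M := by gcongr
      have h5 : τ i * M = δ * (1 / 2) ^ (i + 1) := by simp only [hτ]; field_simp
      rw [pow_succ] at h5 ⊢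
      linarith
  have hZb' : ∀ i, ‖Z i - z‖ ≤ δ := fun i => (hZb i).trans (by
    have h2 : (0 : ℝ) ≤ (1 / 2) ^ i := by positivity
    nlinarith)
  have hZc : CauchySeq Z := by
    refine cauchySeq_of_le_geometric (1 / 2) δ (by norm_num) fun i => ?_
    rw [dist_eq_norm, norm_sub_rev, hZs, add_sub_cancel_left, norm_smul,
      Real.norm_of_nonneg (hτpos i).le, norm_sub_rev]
    calc τ i * ‖Z i - p i (Z i)‖ ≤ τ i * M := by
          gcongr
          exact hYd i _ (hZb' i)
      _ = δ * (1 / 2) ^ (i + 1) := by simp only [hτ]; field_simp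
      _ ≤ δ * (1 / 2) ^ i := by
          gcongr ?_ * ?_
          exact pow_le_pow_of_le_one (by norm_num) (by norm_num) (Nat.le_succ i)
  have hYstep : ∀ i, ‖Y (i + 1) - Y i‖ ^ 2 ≤ 4 * M / δ * ((1 / 2) ^ i) ^ 2 := by
    intro i
    have hnear : ∀ j, ∀ y ∈ S, ‖Z j - Y j‖ ^ 2 ≤ ‖Z j - y‖ ^ 2 + (1 / 8) ^ j := by
      intro j y hy
      have h1 := Metric.infDist_le_dist_of_mem (x := Z j) hy
      rw [dist_eq_norm] at h1
      have h2 : Metric.infDist (Z j) S ^ 2 ≤ ‖Z j - y‖ ^ 2 :=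
        pow_le_pow_left₀ Metric.infDist_nonneg h1 2
      linarith [hp j (Z j)]
    have h := mul_norm_sub_sq_le_of_approx_nearest (hτpos i).le (hτ1 i) (by positivity)
      (hnear i (Y (i + 1)) (hpS _ _)) (hnear (i + 1) (Y i) (hpS _ _))
    have h8 : ((1 : ℝ) / 8) ^ (i + 1) ≤ (1 / 8) ^ i :=
      pow_le_pow_of_le_one (by norm_num) (by norm_num) (Nat.le_succ i)
    have h9 : ((1 : ℝ) / 8) ^ i = ((1 / 2) ^ i) ^ 2 * (1 / 2) ^ i := by
      rw [← pow_mul, mul_comm i 2, pow_mul, ← mul_pow]; norm_num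
    have h10 : τ i * (4 * M / δ * ((1 / 2) ^ i) ^ 2) = 2 * (1 / 8) ^ i := by
      rw [h9]; simp only [hτ, pow_succ]; field_simp; ring
    exact le_of_mul_le_mul_left (by linarith) (hτpos i)
  have hYc : CauchySeq Y := by
    refine cauchySeq_of_le_geometric (1 / 2) (√(4 * M / δ)) (by norm_num) fun i => ?_
    rw [dist_eq_norm, norm_sub_rev]
    refine abs_le_of_sq_le_sq' ?_ (by positivity) |>.2
    rw [mul_pow, Real.sq_sqrt (by positivity)]
    exact hYstep i
  obtain ⟨z', hz'⟩ := cauchySeq_tendsto_of_complete hZc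
  obtain ⟨y', hy'⟩ := cauchySeq_tendsto_of_complete hYc
  have hy'S : y' ∈ S := hcl.mem_of_tendsto hy' (Eventually.of_forall fun i => hpS _ _)
  refine ⟨z', ?_, y', hy'S, ?_⟩
  · exact le_of_tendsto (hz'.sub_const z).norm (Eventually.of_forall hZb')
  · refine le_antisymm ?_ ?_
    · have l1 : Tendsto (fun i => ‖Z i - Y i‖ ^ 2) atTop (𝓝 (‖z' - y'‖ ^ 2)) :=
        ((hz'.sub hy').norm).pow 2
      have l2 : Tendsto (fun i => Metric.infDist (Z i) S ^ 2 + ((1 : ℝ) / 8) ^ i) atTop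
          (𝓝 (Metric.infDist z' S ^ 2 + 0)) :=
        ((((Metric.continuous_infDist_pt S).tendsto z').comp hz').pow 2).add
          (tendsto_pow_atTop_nhds_zero_of_lt_one (by norm_num) (by norm_num))
      have l3 := le_of_tendsto_of_tendsto l1 l2
        (Eventually.of_forall fun i => (hp i (Z i)).le)
      rw [add_zero] at l3
      exact abs_le_of_sq_le_sq' l3 Metric.infDist_nonneg |>.2
    · rw [← dist_eq_norm]; exact Metric.infDist_le_dist_of_mem hy'S

/-! ### Prox-regular sets -/

/-- The normals `ζ` to `S` at `x` that satisfy the quadratic inequality of prox-regularity with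
constant `r = 1 / ρ` at every point of `S`. For a `ρ`-uniformly prox-regular set this is the
proximal normal cone, and also the Clarke normal cone. -/
def regularNormalCone (r : ℝ) (S : Set H) (x : H) : Set H :=
  {ζ | x ∈ S ∧ ∀ x' ∈ S, inner ℝ ζ (x' - x) ≤ ‖ζ‖ / 2 * r * ‖x' - x‖ ^ 2}

/-- It is enough to check the quadratic inequality with some constant: such a `ζ` is a proximal
normal, and prox-regularity replaces the constant by `‖ζ‖ / (2 ρ)`. -/
theorem UniformlyProxRegular.mem_regularNormalCone {ρ : ℝ≥0∞} {S : Set H}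
    (hS : UniformlyProxRegular ρ S) {x ζ : H} {σ : ℝ} (hx : x ∈ S)
    (h : ∀ x' ∈ S, inner ℝ ζ (x' - x) ≤ σ * ‖x' - x‖ ^ 2) :
    ζ ∈ regularNormalCone (ρ⁻¹).toReal S x := by
  refine ⟨hx, hS.2 x hx ζ ⟨hx, |σ|, abs_nonneg σ, 1, one_pos, fun y hy => ?_⟩⟩
  exact (h y hy.1).trans (by gcongr; exact le_abs_self σ)

theorem UniformlyProxRegular.sub_mem_regularNormalCone {ρ : ℝ≥0∞} {S : Set H}
    (hS : UniformlyProxRegular ρ S) {z p : H} (hp : p ∈ S)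
    (h : ‖z - p‖ = Metric.infDist z S) {c : ℝ} (hc : 0 ≤ c) :
    c • (z - p) ∈ regularNormalCone (ρ⁻¹).toReal S p := by
  refine hS.mem_regularNormalCone (σ := c / 2) hp fun y hy => ?_
  have h1 := Metric.infDist_le_dist_of_mem (x := z) hy
  rw [← h, dist_eq_norm] at h1
  have h2 : ‖z - p‖ ^ 2 ≤ ‖z - y‖ ^ 2 := pow_le_pow_left₀ (norm_nonneg _) h1 2
  have e : z - y = (z - p) - (y - p) := by abel
  rw [e, norm_sub_sq_real (z - p)] at h2
  rw [real_inner_smul_left]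
  nlinarith

/-- A point at distance at most `ρ / 2` from a `ρ`-uniformly prox-regular set has a nearest point
in the set. -/
theorem UniformlyProxRegular.exists_nearest [CompleteSpace H] {ρ : ℝ≥0∞} {S : Set H}
    (hS : UniformlyProxRegular ρ S) (hne : S.Nonempty) {z : H}
    (hz : Metric.infDist z S * (ρ⁻¹).toReal ≤ 1 / 2) :
    ∃ p ∈ S, ‖z - p‖ = Metric.infDist z S := by
  set r := (ρ⁻¹).toReal with hr
  have hr0 : 0 ≤ r := ENNReal.toReal_nonneg
  have hch : ∀ i : ℕ, ∃ z' : H, ‖z' - z‖ ≤ (1 / (4 * (r + 1))) * (1 / 2) ^ i ∧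
      ∃ y ∈ S, ‖z' - y‖ = Metric.infDist z' S :=
    fun i => exists_nearest_of_near hne hS.1 z (by positivity)
  choose Z hZ p hpS hp using hch
  have hdr : ∀ i, ‖Z i - p i‖ * r ≤ 3 / 4 := by
    intro i
    rw [hp i]
    have h1 := Metric.infDist_le_infDist_add_dist (s := S) (x := Z i) (y := z)
    rw [dist_eq_norm] at h1
    have h2 : ((1 : ℝ) / 2) ^ i ≤ 1 := pow_le_one₀ (by norm_num) (by norm_num)
    have h3 : ‖Z i - z‖ ≤ 1 / (4 * (r + 1)) :=
      (hZ i).trans (mul_le_of_le_one_right (by positivity) h2)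
    have h4 : 1 / (4 * (r + 1)) * r ≤ 1 / 4 := by
      rw [div_mul_eq_mul_div, div_le_iff₀ (by positivity)]; linarith
    nlinarith
  have hlip : ∀ i j, ‖p i - p j‖ ≤ 4 * ‖Z i - Z j‖ := by
    intro i j
    have hn : ∀ i, Z i - p i ∈ regularNormalCone r S (p i) := fun i => by
      simpa only [one_smul] using hS.sub_mem_regularNormalCone (hpS i) (hp i) zero_le_one
    have h1 := (hn i).2 (p j) (hpS j)
    have h2 := (hn j).2 (p i) (hpS i)
    rw [norm_sub_rev (p j)] at h1
    have e1 : inner ℝ (Z i - Z j) (p i - p j) = ‖p i - p j‖ ^ 2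
        - inner ℝ (Z i - p i) (p j - p i) - inner ℝ (Z j - p j) (p i - p j) := by
      rw [← real_inner_self_eq_norm_sq, ← neg_sub (p i) (p j), inner_neg_right, sub_neg_eq_add,
        ← inner_add_left, ← inner_sub_left]
      congr 1; abel
    have h3 := real_inner_le_norm (Z i - Z j) (p i - p j)
    have h4 : ‖Z i - p i‖ / 2 * r * ‖p i - p j‖ ^ 2 ≤ 3 / 8 * ‖p i - p j‖ ^ 2 := by
      gcongr; linarith [hdr i]
    have h5 : ‖Z j - p j‖ / 2 * r * ‖p i - p j‖ ^ 2 ≤ 3 / 8 * ‖p i - p j‖ ^ 2 := by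
      gcongr; linarith [hdr j]
    rcases (norm_nonneg (p i - p j)).eq_or_lt with h0 | h0
    · rw [← h0]; positivity
    · refine le_of_mul_le_mul_right ?_ h0
      nlinarith
  have hZz : Tendsto Z atTop (𝓝 z) := by
    rw [tendsto_iff_norm_sub_tendsto_zero]
    refine squeeze_zero (fun _ => norm_nonneg _) hZ ?_
    simpa using (tendsto_pow_atTop_nhds_zero_of_lt_one (r := (1 / 2 : ℝ)) (by norm_num)
      (by norm_num)).const_mul (1 / (4 * (r + 1)))
  have hpc : CauchySeq p := by
    have hc := hZz.cauchySeq
    rw [Metric.cauchySeq_iff'] at hc ⊢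
    intro ε hε
    obtain ⟨N, hN⟩ := hc (ε / 4) (by positivity)
    refine ⟨N, fun n hn => ?_⟩
    have := hN n hn
    rw [dist_eq_norm] at this ⊢
    linarith [hlip n N]
  obtain ⟨q, hq⟩ := cauchySeq_tendsto_of_complete hpc
  refine ⟨q, hS.1.mem_of_tendsto hq (Eventually.of_forall hpS), ?_⟩
  have l1 := (hZz.sub hq).norm
  have l2 := ((Metric.continuous_infDist_pt S).tendsto z).comp hZz
  refine tendsto_nhds_unique l1 ?_
  convert l2 using 1
  ext i
  exact hp i

/-- Near a uniformly prox-regular set, approximate projections are close to the projection. -/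
theorem UniformlyProxRegular.norm_sub_sq_le_of_mem_approxProj {ρ : ℝ≥0∞} {S : Set H}
    (hS : UniformlyProxRegular ρ S) {z p y : H} {ε : ℝ}
    (hz : Metric.infDist z S * (ρ⁻¹).toReal ≤ 1 / 2) (hp : p ∈ S)
    (hpz : ‖z - p‖ = Metric.infDist z S) (hy : y ∈ approxProj S ε z) :
    ‖y - p‖ ^ 2 ≤ 2 * ε := by
  have h1 : z - p ∈ regularNormalCone (ρ⁻¹).toReal S p := by
    simpa only [one_smul] using hS.sub_mem_regularNormalCone hp hpz zero_le_one
  have h2 := h1.2 y hy.1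
  have h3 := hy.2
  rw [← hpz] at h3 hz
  have e : z - y = (z - p) - (y - p) := by abel
  rw [e, norm_sub_sq_real (z - p)] at h3
  nlinarith [sq_nonneg ‖y - p‖]

/-! ### Weak limits along ultrafilters -/

/-- Bounded families in a Hilbert space converge weakly along ultrafilters (Banach-Alaoglu). -/
theorem _root_.Ultrafilter.exists_tendsto_inner {G : Type*} [NormedAddCommGroup G]
    [InnerProductSpace ℝ G] [CompleteSpace G] {ι : Type*} (U : Ultrafilter ι) {ζ : ι → G} {M : ℝ}
    (h : ∀ᶠ i in (U : Filter ι), ‖ζ i‖ ≤ M) :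
    ∃ z : G, ∀ y : G, Tendsto (fun i => inner ℝ (ζ i) y) U (𝓝 (inner ℝ z y)) := by
  have hc := (WeakDual.isCompact_closedBall (𝕜 := ℝ) (E := G) 0 M).ultrafilter_le_nhds'
    (U.map fun i => StrongDual.toWeakDual (InnerProductSpace.toDual ℝ G (ζ i))) (by
      change ∀ᶠ i in (U : Filter ι), _
      filter_upwards [h] with i hi
      simpa using hi)
  obtain ⟨φ, -, hφ⟩ := hc
  refine ⟨(InnerProductSpace.toDual ℝ G).symm (WeakDual.toStrongDual φ), fun y => ?_⟩
  have h1 : Tendsto (fun i => StrongDual.toWeakDual (InnerProductSpace.toDual ℝ G (ζ i))) U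
      (𝓝 φ) := hφ
  have h2 := ((WeakDual.eval_continuous (𝕜 := ℝ) y).tendsto φ).comp h1
  rw [InnerProductSpace.toDual_symm_apply]
  exact h2

/-! ### Normal cones of prox-regular sets -/

/-- The polar of the cone of regular normals consists of Clarke tangent vectors. For `u → x` in `S`
and `τ → 0+`, the normalized residual `ζ` of the projection of `u + τ w` onto `S` is a bounded
normal with `‖ζ‖ ^ 2 ≤ O(τ) + ⟪ζ, w⟫`; its weak limits are normals at `x`, so that `⟪ζ, w⟫` has
nonpositive limits and `ζ → 0`. -/
theorem UniformlyProxRegular.mem_clarkeTangentCone [CompleteSpace H] {ρ : ℝ≥0∞} {S : Set H}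
    (hS : UniformlyProxRegular ρ S) {x w : H} (hx : x ∈ S)
    (hw : ∀ ζ ∈ regularNormalCone (ρ⁻¹).toReal S x, inner ℝ ζ w ≤ 0) :
    w ∈ clarkeTangentCone S x := by
  intro u τ huS hu hτ0 hτ
  set r := (ρ⁻¹).toReal with hr
  have hr0 : 0 ≤ r := ENNReal.toReal_nonneg
  have hch : ∀ n, ∃ p ∈ S, Metric.infDist (u n + τ n • w) S * r ≤ 1 / 2 →
      ‖(u n + τ n • w) - p‖ = Metric.infDist (u n + τ n • w) S := by
    intro n
    by_cases h : Metric.infDist (u n + τ n • w) S * r ≤ 1 / 2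
    · obtain ⟨p, hp, e⟩ := hS.exists_nearest ⟨x, hx⟩ h
      exact ⟨p, hp, fun _ => e⟩
    · exact ⟨x, hx, fun h' => absurd h' h⟩
  choose p hpS hp using hch
  set ζ : ℕ → H := fun n => (τ n)⁻¹ • ((u n + τ n • w) - p n) with hζ
  have hdist : ∀ n, Metric.infDist (u n + τ n • w) S ≤ τ n * ‖w‖ := by
    intro n
    have := Metric.infDist_le_dist_of_mem (x := u n + τ n • w) (huS n)
    rwa [dist_eq_norm, add_sub_cancel_left, norm_smul, Real.norm_of_nonneg (hτ0 n).le] at this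
  have hev : ∀ᶠ n in atTop, Metric.infDist (u n + τ n • w) S * r ≤ 1 / 2 := by
    have l : Tendsto (fun n => τ n * ‖w‖ * r) atTop (𝓝 0) := by
      simpa using (hτ.mul_const ‖w‖).mul_const r
    filter_upwards [l.eventually_lt_const (by norm_num : (0 : ℝ) < 1 / 2)] with n hn
    exact (mul_le_mul_of_nonneg_right (hdist n) hr0).trans hn.le
  have hbd : ∀ᶠ n in atTop, ‖ζ n‖ ≤ ‖w‖ ∧ ζ n ∈ regularNormalCone r S (p n) := by
    filter_upwards [hev] with n hn
    refine ⟨?_, hS.sub_mem_regularNormalCone (hpS n) (hp n hn) (inv_nonneg.2 (hτ0 n).le)⟩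
    rw [hζ, norm_smul, norm_inv, Real.norm_of_nonneg (hτ0 n).le, hp n hn, inv_mul_le_iff₀ (hτ0 n)]
    exact hdist n
  have hup : ∀ n, u n - p n = τ n • (ζ n - w) := by
    intro n
    rw [hζ, smul_sub, smul_inv_smul₀ (hτ0 n).ne']; abel
  have hpu : ∀ᶠ n in atTop, ‖u n - p n‖ ≤ τ n * (2 * ‖w‖) := by
    filter_upwards [hbd] with n hn
    rw [hup, norm_smul, Real.norm_of_nonneg (hτ0 n).le]
    have := norm_sub_le (ζ n) w
    exact mul_le_mul_of_nonneg_left (by linarith [hn.1]) (hτ0 n).le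
  have hpx : Tendsto p atTop (𝓝 x) := by
    have h0 : Tendsto (fun n => u n - p n) atTop (𝓝 0) := by
      refine squeeze_zero_norm' hpu ?_
      simpa using hτ.mul_const (2 * ‖w‖)
    simpa using hu.sub h0
  have hζ0 : Tendsto ζ atTop (𝓝 0) := by
    rw [tendsto_iff_ultrafilter]
    intro U hU
    obtain ⟨η, hη⟩ := U.exists_tendsto_inner ((hbd.filter_mono hU).mono fun n hn => hn.1)
    have hηN : η ∈ regularNormalCone r S x := by
      refine hS.mem_regularNormalCone (σ := ‖w‖ / 2 * r) hx fun x' hx' => ?_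
      have l1 : Tendsto (fun n => inner ℝ (ζ n) (x' - p n)) U (𝓝 (inner ℝ η (x' - x))) := by
        have h1 : Tendsto (fun n => inner ℝ (ζ n) (x - p n)) U (𝓝 0) := by
          refine squeeze_zero_norm' (a := fun n => ‖w‖ * ‖x - p n‖) ?_ ?_
          · filter_upwards [hbd.filter_mono hU] with n hn
            refine (abs_real_inner_le_norm _ _).trans ?_
            gcongr
            exact hn.1
          · have := ((tendsto_const_nhds (x := x)).sub (hpx.mono_left hU)).norm.const_mul ‖w‖
            simpa using this
        have h2 := (hη (x' - x)).add h1
        simp only [← inner_add_right, sub_add_sub_cancel, add_zero] at h2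
        exact h2
      have l2 : Tendsto (fun n => ‖w‖ / 2 * r * ‖x' - p n‖ ^ 2) U
          (𝓝 (‖w‖ / 2 * r * ‖x' - x‖ ^ 2)) :=
        (((tendsto_const_nhds.sub (hpx.mono_left hU)).norm).pow 2).const_mul _
      refine le_of_tendsto_of_tendsto l1 l2 ?_
      filter_upwards [hbd.filter_mono hU] with n hn
      refine (hn.2.2 x' hx').trans ?_
      gcongr
      exact hn.1
    have l3 : Tendsto (fun n => ‖w‖ / 2 * r * (2 * ‖w‖) ^ 2 * τ n + inner ℝ (ζ n) w) U
        (𝓝 (inner ℝ η w)) := by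
      simpa using ((hτ.mono_left hU).const_mul (‖w‖ / 2 * r * (2 * ‖w‖) ^ 2)).add (hη w)
    have hle : ∀ᶠ n in (U : Filter ℕ),
        ‖ζ n‖ ^ 2 ≤ ‖w‖ / 2 * r * (2 * ‖w‖) ^ 2 * τ n + inner ℝ (ζ n) w := by
      filter_upwards [hbd.filter_mono hU, hpu.filter_mono hU] with n hn hpu
      have h1 := hn.2.2 (u n) (huS n)
      have h2 : ‖ζ n‖ / 2 * r * ‖u n - p n‖ ^ 2 ≤ ‖w‖ / 2 * r * (τ n * (2 * ‖w‖)) ^ 2 := by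
        gcongr
        exact hn.1
      have e : inner ℝ (ζ n) (u n - p n) = τ n * (‖ζ n‖ ^ 2 - inner ℝ (ζ n) w) := by
        rw [hup, real_inner_smul_right, inner_sub_right, real_inner_self_eq_norm_sq]
      rw [e] at h1
      have h3 : τ n * (‖ζ n‖ ^ 2 - inner ℝ (ζ n) w)
          ≤ τ n * (‖w‖ / 2 * r * (2 * ‖w‖) ^ 2 * τ n) := by nlinarith
      linarith [le_of_mul_le_mul_left h3 (hτ0 n)]
    have h0 : inner ℝ η w = 0 := by
      refine le_antisymm (hw η hηN) ?_
      exact ge_of_tendsto l3 (hle.mono fun n hn => (sq_nonneg _).trans hn)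
    rw [h0] at l3
    have h5 : Tendsto (fun n => ‖ζ n‖ ^ 2) U (𝓝 0) :=
      squeeze_zero' (Eventually.of_forall fun _ => sq_nonneg _) hle l3
    rw [tendsto_zero_iff_norm_tendsto_zero]
    have h6 := h5.sqrt
    simpa using h6
  refine ⟨fun n => w - ζ n, by simpa using tendsto_const_nhds.sub hζ0, fun n => ?_⟩
  have e : u n + τ n • (w - ζ n) = p n := by
    have := hup n
    rw [← neg_sub w, smul_neg] at this
    rw [← sub_eq_zero]
    have e2 : u n + τ n • (w - ζ n) - p n = (u n - p n) + τ n • (w - ζ n) := by abel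
    rw [e2, this]; simp
  rw [e]
  exact hpS n

/-- For uniformly prox-regular sets the Clarke normal cone is not larger than the proximal one:
by Moreau's decomposition with respect to the closed convex cone of regular normals, it is enough
that the polar of the latter consists of Clarke tangent vectors. -/
theorem UniformlyProxRegular.clarkeNormalCone_subset [CompleteSpace H] {ρ : ℝ≥0∞} {S : Set H}
    (hS : UniformlyProxRegular ρ S) (x : H) :
    clarkeNormalCone S x ⊆ regularNormalCone (ρ⁻¹).toReal S x := by
  intro v hv
  have hx := hv.1
  set r := (ρ⁻¹).toReal with hr
  set K := regularNormalCone r S x with hK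
  have h0 : (0 : H) ∈ K := ⟨hx, by simp⟩
  have hcone : ∀ ζ ∈ K, ∀ c : ℝ, 0 ≤ c → c • ζ ∈ K := by
    intro ζ hζ c hc
    refine ⟨hx, fun x' hx' => ?_⟩
    rw [real_inner_smul_left, norm_smul, Real.norm_of_nonneg hc]
    have := mul_le_mul_of_nonneg_left (hζ.2 x' hx') hc
    linarith
  have hadd : ∀ ζ ∈ K, ∀ η ∈ K, ζ + η ∈ K := by
    intro ζ hζ η hη
    refine hS.mem_regularNormalCone (σ := (‖ζ‖ + ‖η‖) / 2 * r) hx fun x' hx' => ?_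
    rw [inner_add_left]
    linarith [hζ.2 x' hx', hη.2 x' hx']
  have hconv : Convex ℝ K := fun ζ hζ η hη a b ha hb _ =>
    hadd _ (hcone ζ hζ a ha) _ (hcone η hη b hb)
  have hcl : IsClosed K := by
    have e : K = ⋂ x' ∈ S, {ζ : H | inner ℝ ζ (x' - x) ≤ ‖ζ‖ / 2 * r * ‖x' - x‖ ^ 2} := by
      ext ζ
      simp [hK, regularNormalCone, hx]
    rw [e]
    exact isClosed_biInter fun x' _ => isClosed_le (by fun_prop) (by fun_prop)
  obtain ⟨k, hk, hmin⟩ := exists_norm_eq_iInf_of_complete_convex ⟨0, h0⟩ hcl.isComplete hconv v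
  rw [norm_eq_iInf_iff_real_inner_le_zero hconv hk] at hmin
  have h1 : inner ℝ (v - k) k = 0 := by
    have a := hmin 0 h0
    have b := hmin ((2 : ℝ) • k) (hcone k hk 2 (by norm_num))
    rw [zero_sub, inner_neg_right] at a
    rw [two_smul, add_sub_cancel_right] at b
    linarith
  have h2 : ∀ ζ ∈ K, inner ℝ ζ (v - k) ≤ 0 := by
    intro ζ hζ
    have := hmin ζ hζ
    rw [inner_sub_right, h1, sub_zero, real_inner_comm] at this
    exact this
  have h3 := hv.2 _ (hS.mem_clarkeTangentCone hx h2)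
  have h4 : inner ℝ v (v - k) = ‖v - k‖ ^ 2 := by
    have e : v = (v - k) + k := by abel
    nth_rewrite 1 [e]
    rw [inner_add_left, real_inner_self_eq_norm_sq, real_inner_comm, h1, add_zero]
  have h5 : v - k = 0 := by
    rw [← norm_eq_zero]
    have : ‖v - k‖ ^ 2 ≤ 0 := by rw [← h4]; exact h3
    exact pow_eq_zero_iff (two_ne_zero) |>.1 (le_antisymm this (sq_nonneg _))
  rw [sub_eq_zero] at h5
  rw [h5]; exact hk

/-- Proximal normals are Clarke normals. -/
theorem mem_clarkeNormalCone {S : Set H} {x ζ : H} {σ : ℝ} (hx : x ∈ S)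
    (h : ∀ x' ∈ S, inner ℝ ζ (x' - x) ≤ σ * ‖x' - x‖ ^ 2) : ζ ∈ clarkeNormalCone S x := by
  refine ⟨hx, fun w hw => ?_⟩
  obtain ⟨W, hW, hWS⟩ := hw (fun _ => x) (fun n => 1 / ((n : ℝ) + 1)) (fun _ => hx)
    tendsto_const_nhds (fun n => by positivity) tendsto_one_div_add_atTop_nhds_zero_nat
  have l1 : Tendsto (fun n => inner ℝ ζ (W n)) atTop (𝓝 (inner ℝ ζ w)) :=
    tendsto_const_nhds.inner hW
  have l2 : Tendsto (fun n : ℕ => σ * (1 / ((n : ℝ) + 1)) * ‖W n‖ ^ 2) atTop (𝓝 0) := by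
    simpa using (tendsto_one_div_add_atTop_nhds_zero_nat.const_mul σ).mul (hW.norm.pow 2)
  refine le_of_tendsto_of_tendsto l1 l2 (Eventually.of_forall fun n => ?_)
  have h1 := h _ (hWS n)
  have hn : (0 : ℝ) < 1 / ((n : ℝ) + 1) := by positivity
  rw [add_sub_cancel_left, real_inner_smul_right, norm_smul, Real.norm_of_nonneg hn.le] at h1
  refine le_of_mul_le_mul_left ?_ hn
  linarith

/-! ### The data of the problem -/

/-- The factor `|L| + 1` in place of `L` makes the distance attained, as the inequality between the
Hausdorff distance and the bound becomes strict. -/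
theorem exists_norm_sub_le_of_hausdorffEDist_le {H : Type*} [NormedAddCommGroup H] {S S' : Set H}
    {L d : ℝ} (h0 : d = 0 → S = S') (hd : 0 ≤ d)
    (h : Metric.hausdorffEDist S S' ≤ ENNReal.ofReal (L * d)) {p : H} (hp : p ∈ S) :
    ∃ q ∈ S', ‖q - p‖ ≤ (|L| + 1) * d := by
  rcases hd.eq_or_lt with h1 | h1
  · exact ⟨p, h0 h1.symm ▸ hp, by simp [← h1]⟩
  · have h2 : Metric.hausdorffEDist S S' < ENNReal.ofReal ((|L| + 1) * d) := by
      refine h.trans_lt ((ENNReal.ofReal_lt_ofReal_iff (by positivity)).2 ?_)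
      nlinarith [le_abs_self L]
    obtain ⟨q, hq, hlt⟩ := Metric.exists_edist_lt_of_hausdorffEDist_lt hp h2
    refine ⟨q, hq, ?_⟩
    rw [edist_dist, ENNReal.ofReal_lt_ofReal_iff (by positivity), dist_comm, dist_eq_norm] at hlt
    exact hlt.le

/-- A one-sided Lipschitz set-valued map whose elements of minimal norm are bounded by a Lipschitz
function `h` is bounded by `h`: compare `y ∈ G x` with a small element of `G (x - s y)` and let
`s → 0`. -/
theorem norm_le_of_oneSidedLipschitz {G : H → Set H} {κ : ℝ} {h : H → ℝ} {L : ℝ≥0}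
    (hne : ∀ x, (G x).Nonempty) (hL : LipschitzWith L h) (h0 : ∀ x, 0 ≤ h x)
    (hinf : ∀ x, Metric.infDist 0 (G x) ≤ h x)
    (hmono : ∀ x x' : H, ∀ y ∈ G x, ∀ y' ∈ G x', inner ℝ (y - y') (x - x') ≤ κ * ‖x - x'‖ ^ 2)
    {x y : H} (hy : y ∈ G x) : ‖y‖ ≤ h x := by
  rcases (norm_nonneg y).eq_or_lt with hy0 | hy0
  · rw [← hy0]; exact h0 x
  have key : ∀ s : ℝ, 0 < s → ‖y‖ ≤ h x + s * (L * ‖y‖ + 1 + κ * ‖y‖) := by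
    intro s hs
    obtain ⟨y', hy', hlt⟩ := (Metric.infDist_lt_iff (hne (x - s • y))).1
      (lt_of_le_of_lt (hinf (x - s • y)) (lt_add_of_pos_right _ hs))
    rw [dist_zero_left] at hlt
    have h1 := hmono _ _ y hy y' hy'
    have h2 := hL.dist_le_mul (x - s • y) x
    rw [dist_eq_norm, dist_eq_norm, sub_sub_cancel_left, norm_neg, norm_smul,
      Real.norm_of_nonneg hs.le] at h2
    have h3 := (le_abs_self _).trans h2
    rw [sub_sub_cancel, real_inner_smul_right, norm_smul, Real.norm_of_nonneg hs.le,
      inner_sub_left, real_inner_self_eq_norm_sq] at h1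
    have h4 := real_inner_le_norm y' y
    have h5 : s * (‖y‖ ^ 2 - ‖y'‖ * ‖y‖) ≤ s * (κ * s * ‖y‖ ^ 2) := by nlinarith
    have h6 := le_of_mul_le_mul_left h5 hs
    have h7 : ‖y‖ * ‖y‖ ≤ (‖y'‖ + κ * s * ‖y‖) * ‖y‖ := by nlinarith
    have h8 := le_of_mul_le_mul_right h7 hy0
    nlinarith
  have hlim : Tendsto (fun s : ℝ => h x + s * (L * ‖y‖ + 1 + κ * ‖y‖)) (𝓝[>] 0) (𝓝 (h x)) := by
    have : Tendsto (fun s : ℝ => h x + s * (L * ‖y‖ + 1 + κ * ‖y‖)) (𝓝 0)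
        (𝓝 (h x + 0 * (L * ‖y‖ + 1 + κ * ‖y‖))) := by
      exact (Continuous.tendsto (by fun_prop) 0)
    simp only [zero_mul, add_zero] at this
    exact this.mono_left nhdsWithin_le_nhds
  exact ge_of_tendsto hlim (by filter_upwards [self_mem_nhdsWithin] with s hs using key s hs)

/-- The standing assumptions, in the form in which they are used: the moving set is Lipschitz in
the sense that its points can be followed, and the perturbation is bounded by `h`. -/
structure StandingAssumptions (T L : ℝ) (ρ : ℝ≥0∞) (C : ℝ → Set H) (F : ℝ → H → Set H)
    (h : H → ℝ) (Lh : ℝ≥0) (k : ℝ → ℝ) : Prop where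
  T_pos : 0 < T
  L_nonneg : 0 ≤ L
  near : ∀ t ∈ Icc 0 T, ∀ s ∈ Icc 0 T, ∀ p ∈ C s, ∃ q ∈ C t, ‖q - p‖ ≤ L * |t - s|
  nonempty : ∀ t ∈ Icc 0 T, (C t).Nonempty
  prox : ∀ t ∈ Icc 0 T, UniformlyProxRegular ρ (C t)
  F_closed : ∀ t ∈ Icc 0 T, ∀ x, IsClosed (F t x)
  F_convex : ∀ t ∈ Icc 0 T, ∀ x, Convex ℝ (F t x)
  F_usc : ∀ t ∈ Icc 0 T, UpperSemicontinuousWeak (F t)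
  h_nonneg : ∀ x, 0 ≤ h x
  h_lip : LipschitzWith Lh h
  F_bound : ∀ᵐ t ∂(volume.restrict (Icc 0 T)), ∀ x, ∀ y ∈ F t x, ‖y‖ ≤ h x
  k_nonneg : ∀ t ∈ Icc 0 T, 0 ≤ k t
  k_int : IntegrableOn k (Icc 0 T)
  F_mono : ∀ t ∈ Icc 0 T, ∀ x x' : H, ∀ y ∈ F t x, ∀ y' ∈ F t x',
    inner ℝ (y - y') (x - x') ≤ k t * ‖x - x'‖ ^ 2

/-! ### Comparison of approximate solutions -/

/-- An approximate solution of the perturbed sweeping process: almost everywhere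
`ẋ = -v + e + g`, where the normal `v`, the error `e` and the perturbation `g` are taken at times
and points that differ from `t` and `x t` by at most `δ`, where `‖e‖ ≤ η`, and where `v` and `g`
are bounded by `m t`. -/
structure IsApproxSolution (T r : ℝ) (C : ℝ → Set H) (F : ℝ → H → Set H) (m : ℝ → ℝ) (δ η : ℝ)
    (x : ℝ → H) : Prop where
  absolutelyContinuous : AbsolutelyContinuousOnInterval x 0 T
  inclusion : ∀ᵐ t ∂(volume.restrict (Icc 0 T)), ∃ v e g p a : H, ∃ θ : ℝ,
    HasDerivAt x (-v + e + g) t ∧ θ ∈ Icc 0 T ∧ |θ - t| ≤ δ ∧ ‖p - x t‖ ≤ δ ∧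
    v ∈ regularNormalCone r (C θ) p ∧ g ∈ F t a ∧ ‖a - x t‖ ≤ δ ∧ ‖v‖ ≤ m t ∧ ‖g‖ ≤ m t ∧ ‖e‖ ≤ η

/-- Contribution of one normal to the derivative of `‖x - y‖ ^ 2`: here `v` is a normal at `p ≈ x`
to a set `S` that has a point `q` near `p' ≈ y`. -/
theorem inner_le_of_mem_regularNormalCone {r : ℝ} {S : Set H} {p v x y p' q : H}
    {σ c M : ℝ} (hr : 0 ≤ r) (hv : v ∈ regularNormalCone r S p) (hq : q ∈ S) (hc : 0 ≤ c)
    (hσ0 : 0 ≤ σ) (hσ2 : σ ≤ 2) (hqp : ‖q - p'‖ ≤ c * σ) (hp : ‖p - x‖ ≤ σ) (hp' : ‖p' - y‖ ≤ σ)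
    (hM : ‖v‖ ≤ M) :
    inner ℝ v (y - x) ≤
      M * (r * ‖x - y‖ ^ 2 + (2 * r * (2 + c) ^ 2 + (2 + c)) * σ) := by
  have hM0 : 0 ≤ M := (norm_nonneg v).trans hM
  have e1 : y - x = (q - p) + (-(p' - y) + -(q - p') + (p - x)) := by abel
  have n1 : ‖-(p' - y) + -(q - p') + (p - x)‖ ≤ (2 + c) * σ := by
    refine (norm_add₃_le).trans ?_
    rw [norm_neg, norm_neg]; linarith
  have n2 : ‖q - p‖ ≤ ‖x - y‖ + (2 + c) * σ := by
    have e2 : q - p = -(x - y) - (-(p' - y) + -(q - p') + (p - x)) := by abel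
    rw [e2]
    refine (norm_sub_le _ _).trans ?_
    rw [norm_neg]; linarith
  have n3 : ‖q - p‖ ^ 2 ≤ 2 * ‖x - y‖ ^ 2 + 4 * (2 + c) ^ 2 * σ := by
    have h1 : ‖q - p‖ ^ 2 ≤ (‖x - y‖ + (2 + c) * σ) ^ 2 :=
      pow_le_pow_left₀ (norm_nonneg _) n2 2
    have h2 : (2 + c) ^ 2 * (σ * σ) ≤ (2 + c) ^ 2 * (2 * σ) := by gcongr
    nlinarith [sq_nonneg (‖x - y‖ - (2 + c) * σ)]
  rw [e1, inner_add_right]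
  have i1 : inner ℝ v (q - p) ≤ M / 2 * r * (2 * ‖x - y‖ ^ 2 + 4 * (2 + c) ^ 2 * σ) := by
    refine (hv.2 q hq).trans ?_
    gcongr
  have i2 : inner ℝ v (-(p' - y) + -(q - p') + (p - x)) ≤ M * ((2 + c) * σ) := by
    refine (real_inner_le_norm _ _).trans ?_
    gcongr
  linarith

/-- Contribution of the perturbations `g ∈ G a` and `g' ∈ G b`, with `a ≈ x` and `b ≈ y`, to the
derivative of `‖x - y‖ ^ 2`. -/
theorem inner_le_of_mem_perturbation {G : H → Set H} {κ : ℝ} (hκ : 0 ≤ κ)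
    (hmono : ∀ x x' : H, ∀ y ∈ G x, ∀ y' ∈ G x', inner ℝ (y - y') (x - x') ≤ κ * ‖x - x'‖ ^ 2)
    {x y a b g g' : H} {σ M M' : ℝ} (hσ0 : 0 ≤ σ) (hσ2 : σ ≤ 2) (hg : g ∈ G a) (hg' : g' ∈ G b)
    (ha : ‖a - x‖ ≤ σ) (hb : ‖b - y‖ ≤ σ) (hM : ‖g‖ ≤ M) (hM' : ‖g'‖ ≤ M') :
    inner ℝ (g - g') (x - y) ≤ κ * (2 * ‖x - y‖ ^ 2 + 16 * σ) + (M + M') * (2 * σ) := by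
  have n0 : ‖(a - x) - (b - y)‖ ≤ 2 * σ := (norm_sub_le _ _).trans (by linarith)
  have e1 : x - y = (a - b) - ((a - x) - (b - y)) := by abel
  have n1 : ‖a - b‖ ≤ ‖x - y‖ + 2 * σ := by
    have e2 : a - b = (x - y) + ((a - x) - (b - y)) := by abel
    rw [e2]
    exact (norm_add_le _ _).trans (by linarith)
  have n2 : ‖a - b‖ ^ 2 ≤ 2 * ‖x - y‖ ^ 2 + 16 * σ := by
    have h1 : ‖a - b‖ ^ 2 ≤ (‖x - y‖ + 2 * σ) ^ 2 := pow_le_pow_left₀ (norm_nonneg _) n1 2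
    nlinarith [sq_nonneg (‖x - y‖ - 2 * σ)]
  have i1 : inner ℝ (g - g') (a - b) ≤ κ * (2 * ‖x - y‖ ^ 2 + 16 * σ) :=
    (hmono a b g hg g' hg').trans (by gcongr)
  have i2 : -inner ℝ (g - g') ((a - x) - (b - y)) ≤ (M + M') * (2 * σ) := by
    refine (neg_le_abs _).trans ((abs_real_inner_le_norm _ _).trans ?_)
    have : ‖g - g'‖ ≤ M + M' := (norm_sub_le _ _).trans (add_le_add hM hM')
    gcongr
    exact (norm_nonneg _).trans this
  rw [e1, inner_sub_right, ← e1]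
  linarith

/-- Two approximate solutions with the same initial value differ by at most a constant times the
sum of their errors. -/
theorem StandingAssumptions.exists_comparison {T L : ℝ} {ρ : ℝ≥0∞} {C : ℝ → Set H}
    {F : ℝ → H → Set H} {h : H → ℝ} {Lh : ℝ≥0} {k : ℝ → ℝ}
    (hA : StandingAssumptions T L ρ C F h Lh k) {m₁ m₂ : ℝ → ℝ}
    (hm₁ : IntegrableOn m₁ (Icc 0 T)) (hm₂ : IntegrableOn m₂ (Icc 0 T))
    (hm₁0 : ∀ t ∈ Icc 0 T, 0 ≤ m₁ t) (hm₂0 : ∀ t ∈ Icc 0 T, 0 ≤ m₂ t) :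
    ∃ K : ℝ, 0 ≤ K ∧ ∀ (δ₁ δ₂ η₁ η₂ : ℝ) (x y : ℝ → H), 0 ≤ δ₁ → 0 ≤ δ₂ → 0 ≤ η₁ → 0 ≤ η₂ →
      δ₁ ≤ 1 → δ₂ ≤ 1 → η₁ ≤ 1 → η₂ ≤ 1 →
      IsApproxSolution T (ρ⁻¹).toReal C F m₁ δ₁ η₁ x →
      IsApproxSolution T (ρ⁻¹).toReal C F m₂ δ₂ η₂ y → x 0 = y 0 →
      ∀ t ∈ Icc 0 T, ‖x t - y t‖ ^ 2 ≤ K * (δ₁ + δ₂ + (η₁ + η₂)) := by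
  set r := (ρ⁻¹).toReal with hr
  have hr0 : 0 ≤ r := ENNReal.toReal_nonneg
  have hL0 := hA.L_nonneg
  have hT := hA.T_pos
  set c := 2 * r * (2 + L) ^ 2 + (2 + L) with hc
  have hc0 : 0 ≤ c := by positivity
  set A : ℝ → ℝ := fun t => 2 * r * (m₁ t + m₂ t) + 4 * k t + 2 with hAdef
  set B : ℝ → ℝ := fun t => (2 * c + 4) * (m₁ t + m₂ t) + 32 * k t with hBdef
  have hconst : ∀ z : ℝ, IntegrableOn (fun _ : ℝ => z) (Icc 0 T) := fun z => by simp
  have hAint : IntegrableOn A (Icc 0 T) :=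
    (((hm₁.add hm₂).const_mul (2 * r)).add (hA.k_int.const_mul 4)).add (hconst 2)
  have hBint : IntegrableOn B (Icc 0 T) :=
    ((hm₁.add hm₂).const_mul (2 * c + 4)).add (hA.k_int.const_mul 32)
  have hA0 : ∀ t ∈ Icc 0 T, 0 ≤ A t := fun t ht => by
    have := hm₁0 t ht; have := hm₂0 t ht; have := hA.k_nonneg t ht
    simp only [hAdef]; positivity
  have hB0 : ∀ t ∈ Icc 0 T, 0 ≤ B t := fun t ht => by
    have := hm₁0 t ht; have := hm₂0 t ht; have := hA.k_nonneg t ht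
    simp only [hBdef]; positivity
  have hIB : 0 ≤ ∫ s in (0 : ℝ)..T, B s := intervalIntegral.integral_nonneg hT.le hB0
  refine ⟨Real.exp (∫ s in (0 : ℝ)..T, A s) * ((∫ s in (0 : ℝ)..T, B s) + T), by positivity, ?_⟩
  intro δ₁ δ₂ η₁ η₂ x y hδ₁ hδ₂ hη₁ hη₂ hδ₁1 hδ₂1 hη₁1 hη₂1 hx hy hxy t ht
  set σ := δ₁ + δ₂ with hσ
  set η := η₁ + η₂ with hη
  have hσ0 : 0 ≤ σ := by positivity
  have hη0 : 0 ≤ η := by positivity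
  have hac : AbsolutelyContinuousOnInterval (fun t => ‖x t - y t‖ ^ 2) 0 T := by
    have h1 := (hx.absolutelyContinuous.fun_sub hy.absolutelyContinuous).lipschitzOnWith_comp
      (lipschitzWith_one_norm.lipschitzOnWith (s := univ)) (mapsTo_univ _ _)
    simpa only [pow_two] using h1.fun_mul h1
  have key := hac.gronwall hT.le hAint ((hBint.mul_const σ).add (hconst η)) hA0
    (fun t ht => add_nonneg (mul_nonneg (hB0 t ht) hσ0) hη0) (by simp [hxy]) (by
    filter_upwards [hx.inclusion, hy.inclusion, ae_restrict_mem measurableSet_Icc]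
      with t hxt hyt ht
    obtain ⟨v, e, g, p, a, θ, hd, hθ, hθt, hp, hv, hg, ha, hvm, hgm, he⟩ := hxt
    obtain ⟨v', e', g', p', a', θ', hd', hθ', hθt', hp', hv', hg', ha', hvm', hgm', he'⟩ := hyt
    refine ⟨_, (hd.sub hd').norm_sq, ?_⟩
    simp only [Pi.sub_apply]
    have hθθ : |θ - θ'| ≤ σ := by
      have e : θ - θ' = (θ - t) - (θ' - t) := by ring
      rw [e]; exact (abs_sub _ _).trans (by linarith)
    obtain ⟨q, hq, hqp⟩ := hA.near θ hθ θ' hθ' p' hv'.1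
    obtain ⟨q', hq', hqp'⟩ := hA.near θ' hθ' θ hθ p hv.1
    rw [abs_sub_comm] at hqp'
    have t1 := inner_le_of_mem_regularNormalCone hr0 hv hq hL0 hσ0 (by linarith)
      (hqp.trans (by gcongr)) (hp.trans (by linarith)) (hp'.trans (by linarith)) hvm
    have t2 := inner_le_of_mem_regularNormalCone hr0 hv' hq' hL0 hσ0 (by linarith)
      (hqp'.trans (by gcongr)) (hp'.trans (by linarith)) (hp.trans (by linarith)) hvm'
    have t3 := inner_le_of_mem_perturbation (hA.k_nonneg t ht) (hA.F_mono t ht) hσ0 (by linarith)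
      hg hg' (ha.trans (by linarith)) (ha'.trans (by linarith)) hgm hgm'
    have t4 : inner ℝ (e - e') (x t - y t) ≤ η / 2 + ‖x t - y t‖ ^ 2 := by
      have n1 : ‖e - e'‖ ≤ η := (norm_sub_le _ _).trans (add_le_add he he')
      refine (real_inner_le_norm _ _).trans ?_
      have n2 : ‖e - e'‖ * ‖x t - y t‖ ≤ η * ‖x t - y t‖ := by gcongr
      nlinarith [sq_nonneg (‖x t - y t‖ - 1), norm_nonneg (x t - y t)]
    rw [norm_sub_rev (y t)] at t2
    have e1 : inner ℝ (x t - y t) (-v + e + g - (-v' + e' + g')) = inner ℝ v (y t - x t)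
        + inner ℝ v' (x t - y t) + inner ℝ (g - g') (x t - y t)
        + inner ℝ (e - e') (x t - y t) := by
      rw [real_inner_comm, ← neg_sub (x t) (y t), inner_neg_right, ← inner_neg_left,
        ← inner_add_left, ← inner_add_left, ← inner_add_left]
      congr 1; abel
    rw [e1]
    simp only [hAdef, hBdef, Pi.add_apply]
    rw [← hc] at t1 t2
    linarith) t ht
  refine key.trans ?_
  have hBint' : IntervalIntegrable (fun s => B s * σ) volume 0 T :=
    (intervalIntegrable_iff_integrableOn_Icc_of_le hT.le).2 (hBint.mul_const σ)
  have e2 : ∫ s in (0 : ℝ)..T, ((fun s => B s * σ) + (fun _ => η) : ℝ → ℝ) s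
      = (∫ s in (0 : ℝ)..T, B s) * σ + T * η := by
    simp only [Pi.add_apply]
    rw [intervalIntegral.integral_add hBint' intervalIntegrable_const,
      intervalIntegral.integral_mul_const, intervalIntegral.integral_const, sub_zero, smul_eq_mul]
  rw [e2, mul_assoc]
  have e3 : (∫ s in (0 : ℝ)..T, B s) * σ + T * η ≤ ((∫ s in (0 : ℝ)..T, B s) + T) * (σ + η) := by
    linarith [mul_nonneg hIB hη0, mul_nonneg hT.le hσ0]
  exact mul_le_mul_of_nonneg_left e3 (Real.exp_pos _).le

/-- Solutions are approximate solutions without errors. The normal `v = g - ẋ` is dominated by an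
integrable function since `ẋ` is, and since `‖g‖ ≤ h x`. -/
theorem StandingAssumptions.exists_bound_isApproxSolution [CompleteSpace H] {T L : ℝ} {ρ : ℝ≥0∞}
    {C : ℝ → Set H} {F : ℝ → H → Set H} {h : H → ℝ} {Lh : ℝ≥0} {k : ℝ → ℝ}
    (hA : StandingAssumptions T L ρ C F h Lh k) {x₀ : H} {x : ℝ → H}
    (hx : IsSolution T C F x₀ x) :
    ∃ m : ℝ → ℝ, IntegrableOn m (Icc 0 T) ∧ (∀ t ∈ Icc 0 T, 0 ≤ m t) ∧
      IsApproxSolution T (ρ⁻¹).toReal C F m 0 0 x := by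
  obtain ⟨m, hm, hmd⟩ := hx.absolutelyContinuous.exists_integrable_bound_deriv hA.T_pos.le
  have hxc : ContinuousOn x (Icc 0 T) := by
    have := hx.absolutelyContinuous.continuousOn
    rwa [uIcc_of_le hA.T_pos.le] at this
  have hhx : IntegrableOn (fun t => h (x t)) (Icc 0 T) :=
    (hA.h_lip.continuous.comp_continuousOn hxc).integrableOn_compact isCompact_Icc
  -- the bound has to be nonnegative everywhere, not only where `x` is differentiable
  refine ⟨fun t => |m t| + h (x t), hm.norm.add hhx,
    fun t _ => add_nonneg (abs_nonneg _) (hA.h_nonneg _), hx.absolutelyContinuous, ?_⟩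
  filter_upwards [hx.inclusion, hmd, hA.F_bound, ae_restrict_mem measurableSet_Icc]
    with t ⟨v, hv, y, hy, hd⟩ hmt hF ht
  have hyb := hF _ y hy
  have hdb := (hmt _ hd).trans (le_abs_self _)
  refine ⟨v, 0, y, x t, x t, t, by simpa using hd, ht, by simp, by simp,
    (hA.prox t ht).clarkeNormalCone_subset _ hv, hy, by simp, ?_,
    hyb.trans (by linarith [abs_nonneg (m t)]), by simp⟩
  have e : v = y - (-v + y) := by abel
  rw [e]
  exact (norm_sub_le _ _).trans (by linarith)

theorem StandingAssumptions.eqOn_of_isSolution [CompleteSpace H] {T L : ℝ} {ρ : ℝ≥0∞}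
    {C : ℝ → Set H} {F : ℝ → H → Set H} {h : H → ℝ} {Lh : ℝ≥0} {k : ℝ → ℝ}
    (hA : StandingAssumptions T L ρ C F h Lh k) {x₀ : H} {x y : ℝ → H}
    (hx : IsSolution T C F x₀ x) (hy : IsSolution T C F x₀ y) : EqOn x y (Icc 0 T) := by
  obtain ⟨m₁, hm₁, hm₁0, hx'⟩ := hA.exists_bound_isApproxSolution hx
  obtain ⟨m₂, hm₂, hm₂0, hy'⟩ := hA.exists_bound_isApproxSolution hy
  obtain ⟨K, -, hK⟩ := hA.exists_comparison hm₁ hm₂ hm₁0 hm₂0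
  intro t ht
  have := hK 0 0 0 0 x y le_rfl le_rfl le_rfl le_rfl zero_le_one zero_le_one zero_le_one
    zero_le_one hx' hy' (hx.initial.trans hy.initial.symm) t ht
  simp only [add_zero, mul_zero] at this
  have h0 := pow_eq_zero_iff (two_ne_zero) |>.1 (le_antisymm this (sq_nonneg _))
  exact sub_eq_zero.1 (norm_eq_zero.1 h0)

/-! ### The uniform partition and functions defined piecewise on it -/

section Partition

variable {T : ℝ} {n : ℕ}

theorem step_pos (hT : 0 < T) (hn : 1 ≤ n) : 0 < step T n := by
  have : (0 : ℝ) < n := by exact_mod_cast hn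
  exact div_pos hT this

theorem step_le (hT : 0 < T) (hn : 1 ≤ n) : step T n ≤ T :=
  div_le_self hT.le (by exact_mod_cast hn)

theorem node_zero (T : ℝ) (n : ℕ) : node T n 0 = 0 := by simp [node]

theorem node_succ (T : ℝ) (n i : ℕ) : node T n (i + 1) = node T n i + step T n := by
  simp only [node]; push_cast; ring

theorem node_self (hn : 1 ≤ n) : node T n n = T := by
  have : (n : ℝ) ≠ 0 := by exact_mod_cast (by omega : n ≠ 0)
  simp only [node, step]; field_simp

theorem node_mem_Icc (hT : 0 < T) (hn : 1 ≤ n) {i : ℕ} (hi : i ≤ n) : node T n i ∈ Icc 0 T := by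
  have h0 := (step_pos hT hn).le
  refine ⟨mul_nonneg (Nat.cast_nonneg _) h0, ?_⟩
  calc node T n i ≤ node T n n := by
        unfold node; gcongr
    _ = T := node_self hn

theorem tendsto_step (T : ℝ) : Tendsto (step T) atTop (𝓝 0) :=
  tendsto_const_div_atTop_nhds_zero_nat T

/-- The function that equals `G i` on the `i`-th interval `]t_i, t_{i+1}]` of the partition. -/
noncomputable def piecewiseOnPartition {E : Type*} (T : ℝ) (n : ℕ) (G : ℕ → ℝ → E) (t : ℝ) : E :=
  G (⌈t / step T n⌉₊ - 1) t

theorem piecewiseOnPartition_eq {E : Type*} (hT : 0 < T) (hn : 1 ≤ n) (G : ℕ → ℝ → E) {i : ℕ}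
    {t : ℝ} (ht : t ∈ Ioc (node T n i) (node T n (i + 1))) :
    piecewiseOnPartition T n G t = G i t := by
  have h0 := step_pos hT hn
  have h1 : ⌈t / step T n⌉₊ = i + 1 := by
    rw [Nat.ceil_eq_iff (Nat.succ_ne_zero i)]
    refine ⟨?_, ?_⟩
    · rw [lt_div_iff₀ h0]; exact ht.1
    · rw [div_le_iff₀ h0]; exact ht.2
  rw [piecewiseOnPartition, h1, Nat.add_sub_cancel]

theorem exists_mem_Ioc_node (hT : 0 < T) (hn : 1 ≤ n) {t : ℝ} (ht : t ∈ Ioc 0 T) :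
    ∃ i < n, t ∈ Ioc (node T n i) (node T n (i + 1)) := by
  have h0 := step_pos hT hn
  have h1 : 0 < ⌈t / step T n⌉₊ := Nat.ceil_pos.2 (div_pos ht.1 h0)
  obtain ⟨i, hi⟩ : ∃ i, ⌈t / step T n⌉₊ = i + 1 := ⟨_, (Nat.succ_pred_eq_of_pos h1).symm⟩
  have h2 := (Nat.ceil_eq_iff (Nat.succ_ne_zero i)).1 hi
  rw [Nat.succ_sub_one, lt_div_iff₀ h0, div_le_iff₀ h0] at h2
  refine ⟨i, ?_, h2⟩
  by_contra hni
  have h3 : node T n n ≤ node T n i := by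
    unfold node; gcongr; omega
  rw [node_self hn] at h3
  exact absurd (h3.trans_lt h2.1) (not_lt.2 ht.2)

variable {E : Type*} [NormedAddCommGroup E] {G : ℕ → ℝ → E}

theorem intervalIntegrable_piecewiseOnPartition_Ioc (hT : 0 < T) (hn : 1 ≤ n) {i : ℕ}
    (hG : IntervalIntegrable (G i) volume (node T n i) (node T n (i + 1))) :
    IntervalIntegrable (piecewiseOnPartition T n G) volume (node T n i) (node T n (i + 1)) := by
  have hle : node T n i ≤ node T n (i + 1) := by
    rw [node_succ]; linarith [step_pos hT hn]
  rw [intervalIntegrable_iff_integrableOn_Ioc_of_le hle] at hG ⊢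
  exact hG.congr_fun (fun t ht => (piecewiseOnPartition_eq hT hn G ht).symm) measurableSet_Ioc

theorem intervalIntegrable_piecewiseOnPartition (hT : 0 < T) (hn : 1 ≤ n)
    (hG : ∀ i < n, IntervalIntegrable (G i) volume (node T n i) (node T n (i + 1))) {i : ℕ}
    (hi : i ≤ n) : IntervalIntegrable (piecewiseOnPartition T n G) volume 0 (node T n i) := by
  induction i with
  | zero => rw [node_zero]
  | succ i ih =>
    exact (ih (by omega)).trans (intervalIntegrable_piecewiseOnPartition_Ioc hT hn (hG i (by omega)))

theorem integrableOn_piecewiseOnPartition (hT : 0 < T) (hn : 1 ≤ n)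
    (hG : ∀ i < n, IntervalIntegrable (G i) volume (node T n i) (node T n (i + 1))) :
    IntegrableOn (piecewiseOnPartition T n G) (Icc 0 T) := by
  rw [← intervalIntegrable_iff_integrableOn_Icc_of_le hT.le]
  have := intervalIntegrable_piecewiseOnPartition hT hn hG le_rfl
  rwa [node_self hn] at this

/-- A function that is pieced together from indefinite integrals is an indefinite integral. -/
theorem eq_add_integral_piecewiseOnPartition [NormedSpace ℝ E] (hT : 0 < T) (hn : 1 ≤ n)
    (hG : ∀ i < n, IntervalIntegrable (G i) volume (node T n i) (node T n (i + 1)))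
    {X : ℕ → E} {x : ℝ → E} (hx0 : x 0 = X 0)
    (hX : ∀ i < n, X (i + 1) = X i + ∫ s in (node T n i)..(node T n (i + 1)), G i s)
    (hx : ∀ i < n, ∀ t ∈ Ioc (node T n i) (node T n (i + 1)),
      x t = X i + ∫ s in (node T n i)..t, G i s) {t : ℝ} (ht : t ∈ Icc 0 T) :
    x t = x 0 + ∫ s in (0 : ℝ)..t, piecewiseOnPartition T n G s := by
  have hstep : ∀ i < n, ∀ t ∈ Icc (node T n i) (node T n (i + 1)),
      ∫ s in (node T n i)..t, piecewiseOnPartition T n G s = ∫ s in (node T n i)..t, G i s := by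
    intro i hi t ht
    refine intervalIntegral.integral_congr_ae (Eventually.of_forall fun s hs => ?_)
    rw [uIoc_of_le ht.1] at hs
    exact piecewiseOnPartition_eq hT hn G ⟨hs.1, hs.2.trans ht.2⟩
  have hle : ∀ i, node T n i ≤ node T n (i + 1) := fun i => by
    rw [node_succ]; linarith [step_pos hT hn]
  have hnode : ∀ i ≤ n, X i = x 0 + ∫ s in (0 : ℝ)..(node T n i), piecewiseOnPartition T n G s := by
    intro i
    induction i with
    | zero => intro _; simp [node_zero, hx0]
    | succ i ih =>
      intro hi
      rw [hX i (by omega), ih (by omega),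
        ← hstep i (by omega) (node T n (i + 1)) ⟨hle i, le_rfl⟩, add_assoc,
        intervalIntegral.integral_add_adjacent_intervals
          (intervalIntegrable_piecewiseOnPartition hT hn hG (by omega))
          (intervalIntegrable_piecewiseOnPartition_Ioc hT hn (hG i (by omega)))]
  rcases ht.1.eq_or_lt with h0 | h0
  · simp [← h0]
  · obtain ⟨i, hi, hti⟩ := exists_mem_Ioc_node hT hn ⟨h0, ht.2⟩
    rw [hx i hi t hti, hnode i hi.le, ← hstep i hi t ⟨hti.1.le, hti.2⟩, add_assoc,
      intervalIntegral.integral_add_adjacent_intervals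
        (intervalIntegrable_piecewiseOnPartition hT hn hG hi.le)
        ((intervalIntegrable_piecewiseOnPartition_Ioc hT hn (hG i hi)).mono_set ?_)]
    rw [uIcc_of_le hti.1.le, uIcc_of_le (hle i)]
    exact Icc_subset_Icc_right hti.2

end Partition

/-! ### Decomposition of the velocity -/

/-- `x` is an indefinite integral of `-v + e + g`, where `v`, `e` and `g` are as in
`IsApproxSolution`, with a constant bound `M`. -/
structure HasVelocity (T r : ℝ) (C : ℝ → Set H) (F : ℝ → H → Set H) (M δ η : ℝ)
    (x v e g : ℝ → H) : Prop where
  integrable_v : IntegrableOn v (Icc 0 T)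
  integrable_e : IntegrableOn e (Icc 0 T)
  integrable_g : IntegrableOn g (Icc 0 T)
  eq_integral : ∀ t ∈ Icc 0 T, x t = x 0 + ∫ s in (0 : ℝ)..t, (-v s + e s + g s)
  inclusion : ∀ᵐ t ∂(volume.restrict (Icc 0 T)), ∃ p a : H, ∃ θ : ℝ,
    θ ∈ Icc 0 T ∧ |θ - t| ≤ δ ∧ ‖p - x t‖ ≤ δ ∧ v t ∈ regularNormalCone r (C θ) p ∧
    g t ∈ F t a ∧ ‖a - x t‖ ≤ δ ∧ ‖v t‖ ≤ M ∧ ‖g t‖ ≤ M ∧ ‖e t‖ ≤ η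

theorem lipschitzOnWith_of_eq_integral {T : ℝ} (hT : 0 ≤ T) {x w : ℝ → H} {K : ℝ≥0}
    (hw : IntegrableOn w (Icc 0 T)) (hK : ∀ᵐ t ∂(volume.restrict (Icc 0 T)), ‖w t‖ ≤ K)
    (hx : ∀ t ∈ Icc 0 T, x t = x 0 + ∫ s in (0 : ℝ)..t, w s) : LipschitzOnWith K x (Icc 0 T) := by
  refine LipschitzOnWith.of_dist_le_mul fun t ht s hs => ?_
  have hint : ∀ a ∈ Icc 0 T, IntervalIntegrable w volume 0 a := fun a ha =>
    ((intervalIntegrable_iff_integrableOn_Icc_of_le hT).2 hw).mono_set (by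
      rw [uIcc_of_le ha.1, uIcc_of_le hT]; exact Icc_subset_Icc_right ha.2)
  rw [dist_eq_norm, hx t ht, hx s hs, add_sub_add_left_eq_sub,
    intervalIntegral.integral_interval_sub_left (hint t ht) (hint s hs), Real.dist_eq]
  refine intervalIntegral.norm_integral_le_of_norm_le_const_ae ?_
  rw [ae_restrict_iff' measurableSet_Icc] at hK
  filter_upwards [hK] with u hu hu'
  refine hu ?_
  have := uIoc_subset_uIcc hu'
  exact (convex_Icc 0 T).ordConnected.uIcc_subset hs ht this

theorem ae_hasDerivAt_of_eq_integral [CompleteSpace H] {T : ℝ} (hT : 0 ≤ T) {x w : ℝ → H}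
    (hw : IntegrableOn w (Icc 0 T)) (hx : ∀ t ∈ Icc 0 T, x t = x 0 + ∫ s in (0 : ℝ)..t, w s) :
    ∀ᵐ t ∂(volume.restrict (Icc 0 T)), HasDerivAt x (w t) t := by
  have hw' := (intervalIntegrable_iff_integrableOn_Icc_of_le hT).2 hw
  have h1 : ∀ᵐ t : ℝ, t ≠ 0 := by simp [ae_iff, measure_singleton]
  have h2 : ∀ᵐ t : ℝ, t ≠ T := by simp [ae_iff, measure_singleton]
  filter_upwards [ae_restrict_of_ae hw'.ae_hasDerivAt_integral, ae_restrict_of_ae h1,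
    ae_restrict_of_ae h2, ae_restrict_mem measurableSet_Icc] with t hd h1 h2 ht
  have hnhds : Icc 0 T ∈ 𝓝 t :=
    Icc_mem_nhds (lt_of_le_of_ne ht.1 h1.symm) (lt_of_le_of_ne ht.2 h2)
  have h3 := (hd (by rwa [uIcc_of_le hT]) 0 (by simp)).const_add (x 0)
  refine h3.congr_of_eventuallyEq ?_
  filter_upwards [hnhds] with s hs using hx s hs

theorem HasVelocity.isApproxSolution [CompleteSpace H] {T r : ℝ} {C : ℝ → Set H}
    {F : ℝ → H → Set H} {M δ η : ℝ} {x v e g : ℝ → H} (hT : 0 ≤ T) (hM : 0 ≤ M) (hη : 0 ≤ η)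
    (hx : HasVelocity T r C F M δ η x v e g) :
    IsApproxSolution T r C F (fun _ => M) δ η x := by
  have hw : IntegrableOn (fun s => -v s + e s + g s) (Icc 0 T) :=
    (hx.integrable_v.neg.add hx.integrable_e).add hx.integrable_g
  refine ⟨?_, ?_⟩
  · have hK : ∀ᵐ t ∂(volume.restrict (Icc 0 T)),
        ‖-v t + e t + g t‖ ≤ (⟨M + η + M, by positivity⟩ : ℝ≥0) := by
      filter_upwards [hx.inclusion] with t ⟨p, a, θ, _, _, _, _, _, _, h1, h2, h3⟩
      refine norm_add₃_le.trans ?_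
      rw [norm_neg]
      change _ ≤ M + η + M
      gcongr
    have := lipschitzOnWith_of_eq_integral hT hw hK hx.eq_integral
    rw [← uIcc_of_le hT] at this
    exact this.absolutelyContinuousOnInterval
  · filter_upwards [hx.inclusion, ae_hasDerivAt_of_eq_integral hT hw hx.eq_integral]
      with t ⟨p, a, θ, h1, h2, h3, h4, h5, h6, h7, h8, h9⟩ hd
    exact ⟨v t, e t, g t, p, a, θ, hd, h1, h2, h3, h4, h5, h6, h7, h8, h9⟩

/-! ### The catching-up algorithm -/

/-- One run of the algorithm, for a fixed number `n ≥ 1` of steps. -/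
structure IsCatchingUpRun (T : ℝ) (C : ℝ → Set H) (f : ℝ → H → H) (ε : ℝ) (x₀ : H) (n : ℕ)
    (X : ℕ → H) (x : ℝ → H) : Prop where
  pos : 1 ≤ n
  iterate_zero : X 0 = x₀
  iterate_succ : ∀ i < n, X (i + 1) ∈ approxProj (C (node T n (i + 1))) ε
    (X i + ∫ s in (node T n i)..(node T n (i + 1)), f s (X i))
  apply_zero : x 0 = x₀
  apply_Ioc : ∀ i < n, ∀ t ∈ Ioc (node T n i) (node T n (i + 1)),
    x t = X i
      + ((t - node T n i) / step T n) •
          (X (i + 1) - X i - ∫ s in (node T n i)..(node T n (i + 1)), f s (X i))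
      + ∫ s in (node T n i)..t, f s (X i)

theorem IsCatchingUp.run {T : ℝ} {C : ℝ → Set H} {f : ℝ → H → H} {ε : ℕ → ℝ} {x₀ : H}
    {X : ℕ → ℕ → H} {xs : ℕ → ℝ → H} (h : IsCatchingUp T C f ε x₀ X xs) {n : ℕ} (hn : 1 ≤ n) :
    IsCatchingUpRun T C f (ε n) x₀ n (X n) (xs n) :=
  ⟨hn, h.iterate_zero n hn, h.iterate_succ n hn, h.apply_zero n hn, h.apply_Ioc n hn⟩

theorem exists_isCatchingUp {T : ℝ} {C : ℝ → Set H} (hT : 0 < T)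
    (hC : ∀ t ∈ Icc 0 T, (C t).Nonempty) (f : ℝ → H → H) {ε : ℕ → ℝ} (hε : ∀ n, 1 ≤ n → 0 < ε n)
    (x₀ : H) : ∃ X xs, IsCatchingUp T C f ε x₀ X xs := by
  have hch : ∀ (n i : ℕ) (z : H), ∃ y, 1 ≤ n → i < n →
      y ∈ approxProj (C (node T n (i + 1))) (ε n) z := by
    intro n i z
    by_cases h : 1 ≤ n ∧ i < n
    · obtain ⟨y, hy⟩ := approxProj_nonempty (hC _ (node_mem_Icc hT h.1 h.2)) (hε n h.1) z
      exact ⟨y, fun _ _ => hy⟩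
    · exact ⟨z, fun h1 h2 => absurd ⟨h1, h2⟩ h⟩
  choose P hP using hch
  set X : ℕ → ℕ → H := fun n i => Nat.rec x₀
    (fun i y => P n i (y + ∫ s in (node T n i)..(node T n (i + 1)), f s y)) i with hX
  set W : ℕ → ℕ → ℝ → H := fun n i t => X n i
      + ((t - node T n i) / step T n) •
          (X n (i + 1) - X n i - ∫ s in (node T n i)..(node T n (i + 1)), f s (X n i))
      + ∫ s in (node T n i)..t, f s (X n i) with hW
  refine ⟨X, fun n t => if t = 0 then x₀ else piecewiseOnPartition T n (W n) t, ?_⟩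
  refine ⟨fun n _ => rfl, fun n hn i hi => hP n i _ hn hi, fun n _ => by simp, ?_⟩
  intro n hn i hi t ht
  have h0 : t ≠ 0 := ((node_mem_Icc hT hn hi.le).1.trans_lt ht.1).ne'
  simp only [h0, if_false]
  rw [piecewiseOnPartition_eq hT hn _ ht]

variable {T L : ℝ} {ρ : ℝ≥0∞} {C : ℝ → Set H} {F : ℝ → H → Set H} {h : H → ℝ} {Lh : ℝ≥0}
  {k : ℝ → ℝ} {γ : ℝ} {f : ℝ → H → H}

theorem StandingAssumptions.ae_norm_selection_le (hA : StandingAssumptions T L ρ C F h Lh k)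
    (hf : IsMeasurableSelection T F γ f) :
    ∀ᵐ t ∂(volume.restrict (Icc 0 T)), ∀ x, ‖f t x‖ ≤ h x := by
  filter_upwards [hA.F_bound, ae_restrict_mem measurableSet_Icc] with t ht htT x
  exact ht x _ (hf.1 t htT x).1

theorem StandingAssumptions.intervalIntegrable_selection
    (hA : StandingAssumptions T L ρ C F h Lh k) (hf : IsMeasurableSelection T F γ f) (x : H)
    {a b : ℝ} (ha : a ∈ Icc 0 T) (hb : b ∈ Icc 0 T) :
    IntervalIntegrable (fun t => f t x) volume a b := by
  have h1 : IntegrableOn (fun t => f t x) (Icc 0 T) :=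
    Integrable.mono' (integrable_const (h x)) (hf.2 x)
      ((hA.ae_norm_selection_le hf).mono fun t ht => ht x)
  refine ((intervalIntegrable_iff_integrableOn_Icc_of_le hA.T_pos.le).2 h1).mono_set ?_
  rw [uIcc_of_le hA.T_pos.le]
  exact (convex_Icc 0 T).ordConnected.uIcc_subset ha hb

theorem StandingAssumptions.norm_integral_selection_le
    (hA : StandingAssumptions T L ρ C F h Lh k) (hf : IsMeasurableSelection T F γ f) (x : H)
    {a b : ℝ} (ha : a ∈ Icc 0 T) (hb : b ∈ Icc 0 T) :
    ‖∫ s in a..b, f s x‖ ≤ h x * |b - a| := by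
  refine intervalIntegral.norm_integral_le_of_norm_le_const_ae ?_
  have := hA.ae_norm_selection_le hf
  rw [ae_restrict_iff' measurableSet_Icc] at this
  filter_upwards [this] with t ht ht'
  exact ht ((convex_Icc 0 T).ordConnected.uIcc_subset ha hb (uIoc_subset_uIcc ht')) x

section Run

variable {ε c : ℝ} {x₀ : H} {n : ℕ} {X : ℕ → H} {x : ℝ → H}

theorem IsCatchingUpRun.iterate_mem (hrun : IsCatchingUpRun T C f ε x₀ n X x) (hx₀ : x₀ ∈ C 0)
    {i : ℕ} (hi : i ≤ n) : X i ∈ C (node T n i) := by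
  cases i with
  | zero => rw [hrun.iterate_zero, node_zero]; exact hx₀
  | succ i => exact (hrun.iterate_succ i (by omega)).1

theorem IsCatchingUpRun.infDist_le (hrun : IsCatchingUpRun T C f ε x₀ n X x)
    (hA : StandingAssumptions T L ρ C F h Lh k) (hf : IsMeasurableSelection T F γ f)
    (hx₀ : x₀ ∈ C 0) {i : ℕ} (hi : i < n) :
    Metric.infDist (X i + ∫ s in (node T n i)..(node T n (i + 1)), f s (X i))
      (C (node T n (i + 1))) ≤ step T n * (h (X i) + L) := by
  have hμ := step_pos hA.T_pos hrun.pos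
  have hi0 := node_mem_Icc hA.T_pos hrun.pos hi.le
  have hi1 := node_mem_Icc hA.T_pos hrun.pos hi
  have e : node T n (i + 1) - node T n i = step T n := by rw [node_succ]; ring
  have h1 := hA.norm_integral_selection_le hf (X i) hi0 hi1
  obtain ⟨q, hq, hqX⟩ := hA.near _ hi1 _ hi0 _ (hrun.iterate_mem hx₀ hi.le)
  rw [e, abs_of_pos hμ] at h1 hqX
  refine (Metric.infDist_le_dist_of_mem hq).trans ?_
  rw [dist_eq_norm]
  set I := ∫ s in (node T n i)..(node T n (i + 1)), f s (X i)
  have e2 : X i + I - q = I - (q - X i) := by abel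
  rw [e2]
  exact (norm_sub_le _ _).trans (by linarith)

theorem norm_sub_le_of_mem_approxProj {E : Type*} [NormedAddCommGroup E] {S : Set E} {z y : E}
    (hε : 0 ≤ ε)
    (hy : y ∈ approxProj S ε z) : ‖z - y‖ ≤ Metric.infDist z S + √ε := by
  refine abs_le_of_sq_le_sq' ?_ (add_nonneg Metric.infDist_nonneg (Real.sqrt_nonneg _)) |>.2
  have h1 := hy.2
  have h2 := Real.sq_sqrt hε
  have h3 : 0 ≤ Metric.infDist z S := Metric.infDist_nonneg
  nlinarith [mul_nonneg h3 (Real.sqrt_nonneg ε)]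

theorem IsCatchingUpRun.norm_iterate_succ_sub_le (hrun : IsCatchingUpRun T C f ε x₀ n X x)
    (hA : StandingAssumptions T L ρ C F h Lh k) (hf : IsMeasurableSelection T F γ f)
    (hx₀ : x₀ ∈ C 0) (hε : 0 ≤ ε) (hc : √ε ≤ c * step T n) {i : ℕ} (hi : i < n) :
    ‖X (i + 1) - X i‖ ≤ step T n * (2 * h (X i) + L + c) := by
  have hμ := step_pos hA.T_pos hrun.pos
  have hi0 := node_mem_Icc hA.T_pos hrun.pos hi.le
  have hi1 := node_mem_Icc hA.T_pos hrun.pos hi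
  have e : node T n (i + 1) - node T n i = step T n := by rw [node_succ]; ring
  have h1 := hA.norm_integral_selection_le hf (X i) hi0 hi1
  rw [e, abs_of_pos hμ] at h1
  have h2 := norm_sub_le_of_mem_approxProj hε (hrun.iterate_succ i hi)
  have h3 := hrun.infDist_le hA hf hx₀ hi
  set I := ∫ s in (node T n i)..(node T n (i + 1)), f s (X i)
  have e2 : X (i + 1) - X i = I - (X i + I - X (i + 1)) := by abel
  rw [e2]
  exact (norm_sub_le _ _).trans (by linarith)

/-- A priori bound for the iterates, uniform in the run: the discrete Grönwall inequality. -/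
theorem IsCatchingUpRun.norm_iterate_sub_le (hrun : IsCatchingUpRun T C f ε x₀ n X x)
    (hA : StandingAssumptions T L ρ C F h Lh k) (hf : IsMeasurableSelection T F γ f)
    (hx₀ : x₀ ∈ C 0) (hε : 0 ≤ ε) (hc0 : 0 ≤ c) (hc : √ε ≤ c * step T n) {i : ℕ} (hi : i ≤ n) :
    ‖X i - x₀‖ ≤ T * (2 * h x₀ + L + c) * Real.exp (2 * Lh * T) := by
  have hμ := step_pos hA.T_pos hrun.pos
  have hL := hA.L_nonneg
  have hh := hA.h_nonneg x₀
  set b := 2 * h x₀ + L + c with hb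
  have hb0 : 0 ≤ b := by positivity
  have key : ∀ i ≤ n, ‖X i - x₀‖ ≤ node T n i * b * Real.exp (2 * Lh * node T n i) := by
    intro i
    induction i with
    | zero => intro _; simp [node_zero, hrun.iterate_zero]
    | succ i ih =>
      intro hi
      have ih := ih (by omega)
      have h1 := hrun.norm_iterate_succ_sub_le hA hf hx₀ hε hc (by omega : i < n)
      have h2 := (le_abs_self _).trans (hA.h_lip.dist_le_mul (X i) x₀)
      rw [dist_eq_norm] at h2
      have hν := (node_mem_Icc hA.T_pos hrun.pos (by omega : i ≤ n)).1
      rw [node_succ]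
      set ν := node T n i
      set μ := step T n
      have e : X (i + 1) - x₀ = (X (i + 1) - X i) + (X i - x₀) := by abel
      have h3 : ‖X (i + 1) - x₀‖ ≤ ‖X i - x₀‖ * (1 + 2 * Lh * μ) + μ * b := by
        rw [e]
        refine (norm_add_le _ _).trans ?_
        have : μ * (2 * h (X i) + L + c) ≤ μ * (2 * (Lh * ‖X i - x₀‖) + b) :=
          mul_le_mul_of_nonneg_left (by linarith) hμ.le
        linarith
      have hLh : (0 : ℝ) ≤ Lh := Lh.2
      have h4 : 1 + 2 * Lh * μ ≤ Real.exp (2 * Lh * μ) := by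
        rw [add_comm]; exact Real.add_one_le_exp _
      have h5 : Real.exp (2 * Lh * (ν + μ)) = Real.exp (2 * Lh * ν) * Real.exp (2 * Lh * μ) := by
        rw [← Real.exp_add]; ring_nf
      have h6 : 1 ≤ Real.exp (2 * Lh * (ν + μ)) := Real.one_le_exp (by positivity)
      calc ‖X (i + 1) - x₀‖ ≤ ‖X i - x₀‖ * (1 + 2 * Lh * μ) + μ * b := h3
        _ ≤ (ν * b * Real.exp (2 * Lh * ν)) * Real.exp (2 * Lh * μ) + μ * b * 1 := by
            rw [mul_one]; gcongr
        _ ≤ (ν * b * Real.exp (2 * Lh * ν)) * Real.exp (2 * Lh * μ)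
            + μ * b * Real.exp (2 * Lh * (ν + μ)) := by gcongr
        _ = (ν + μ) * b * Real.exp (2 * Lh * (ν + μ)) := by rw [h5]; ring
  have hn := node_mem_Icc hA.T_pos hrun.pos hi
  refine (key i hi).trans ?_
  have hLh : (0 : ℝ) ≤ Lh := Lh.2
  have hTb : 0 ≤ T * b := mul_nonneg hA.T_pos.le hb0
  gcongr
  · exact hn.2
  · exact hn.2

/-- A common bound for `h` along all runs of the algorithm with `√ε ≤ c μ`. -/
noncomputable def growthBound (T L : ℝ) (h : H → ℝ) (Lh : ℝ≥0) (x₀ : H) (c : ℝ) : ℝ :=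
  h x₀ + Lh * (T * (2 * h x₀ + L + c) * Real.exp (2 * Lh * T))

theorem growthBound_nonneg (hA : StandingAssumptions T L ρ C F h Lh k) (hc0 : 0 ≤ c) :
    0 ≤ growthBound T L h Lh x₀ c := by
  have := hA.L_nonneg
  have := hA.h_nonneg x₀
  have := hA.T_pos
  unfold growthBound
  positivity

theorem IsCatchingUpRun.h_iterate_le (hrun : IsCatchingUpRun T C f ε x₀ n X x)
    (hA : StandingAssumptions T L ρ C F h Lh k) (hf : IsMeasurableSelection T F γ f)
    (hx₀ : x₀ ∈ C 0) (hε : 0 ≤ ε) (hc0 : 0 ≤ c) (hc : √ε ≤ c * step T n) {i : ℕ} (hi : i ≤ n) :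
    h (X i) ≤ growthBound T L h Lh x₀ c := by
  have h1 := (le_abs_self _).trans (hA.h_lip.dist_le_mul (X i) x₀)
  rw [dist_eq_norm] at h1
  have h2 : Lh * ‖X i - x₀‖ ≤ Lh * (T * (2 * h x₀ + L + c) * Real.exp (2 * Lh * T)) := by
    gcongr; exact hrun.norm_iterate_sub_le hA hf hx₀ hε hc0 hc hi
  unfold growthBound
  linarith

/-- The interpolation stays within a distance of order `μ` of the last iterate. -/
theorem IsCatchingUpRun.norm_apply_sub_iterate_le (hrun : IsCatchingUpRun T C f ε x₀ n X x)
    (hA : StandingAssumptions T L ρ C F h Lh k) (hf : IsMeasurableSelection T F γ f)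
    (hx₀ : x₀ ∈ C 0) (hε : 0 ≤ ε) (hc0 : 0 ≤ c) (hc : √ε ≤ c * step T n) {i : ℕ} (hi : i < n)
    {t : ℝ} (ht : t ∈ Ioc (node T n i) (node T n (i + 1))) :
    ‖x t - X i‖ ≤ 2 * (2 * growthBound T L h Lh x₀ c + L + c) * step T n := by
  have hμ := step_pos hA.T_pos hrun.pos
  have hi0 := node_mem_Icc hA.T_pos hrun.pos hi.le
  have hi1 := node_mem_Icc hA.T_pos hrun.pos hi
  have hM := hrun.h_iterate_le hA hf hx₀ hε hc0 hc hi.le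
  have h1 := hA.norm_integral_selection_le hf (X i) hi0 hi1
  have h2 := hA.norm_integral_selection_le hf (X i) hi0 ⟨hi0.1.trans ht.1.le, ht.2.trans hi1.2⟩
  have h3 := hrun.norm_iterate_succ_sub_le hA hf hx₀ hε hc hi
  have e : node T n (i + 1) - node T n i = step T n := by rw [node_succ]; ring
  rw [e, abs_of_pos hμ] at h1
  rw [abs_of_nonneg (by linarith [ht.1])] at h2
  have hτ0 : 0 ≤ (t - node T n i) / step T n := div_nonneg (by linarith [ht.1]) hμ.le
  have hτ1 : (t - node T n i) / step T n ≤ 1 := (div_le_one hμ).2 (by linarith [ht.2])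
  have h4 : h (X i) * (t - node T n i) ≤ h (X i) * step T n :=
    mul_le_mul_of_nonneg_left (by linarith [ht.2]) (hA.h_nonneg _)
  rw [hrun.apply_Ioc i hi t ht, add_assoc, add_sub_cancel_left]
  refine (norm_add_le _ _).trans ?_
  rw [norm_smul, Real.norm_of_nonneg hτ0]
  have h5 := mul_le_of_le_one_left (norm_nonneg
    (X (i + 1) - X i - ∫ s in (node T n i)..(node T n (i + 1)), f s (X i))) hτ1
  have h6 := norm_sub_le (X (i + 1) - X i) (∫ s in (node T n i)..(node T n (i + 1)), f s (X i))
  have h7 : step T n * (2 * h (X i) + L + c) ≤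
      step T n * (2 * growthBound T L h Lh x₀ c + L + c) := by gcongr
  have h8 : h (X i) * step T n ≤ growthBound T L h Lh x₀ c * step T n := by gcongr
  have h9 : 0 ≤ (L + c) * step T n := mul_nonneg (add_nonneg hA.L_nonneg hc0) hμ.le
  linarith

/-- A priori bound for the interpolation, uniform in the run and in time. -/
theorem IsCatchingUpRun.norm_apply_sub_le (hrun : IsCatchingUpRun T C f ε x₀ n X x)
    (hA : StandingAssumptions T L ρ C F h Lh k) (hf : IsMeasurableSelection T F γ f)
    (hx₀ : x₀ ∈ C 0) (hε : 0 ≤ ε) (hc0 : 0 ≤ c) (hc : √ε ≤ c * step T n) {t : ℝ}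
    (ht : t ∈ Icc 0 T) :
    ‖x t - x₀‖ ≤ 2 * (2 * growthBound T L h Lh x₀ c + L + c) * T
      + T * (2 * h x₀ + L + c) * Real.exp (2 * Lh * T) := by
  have hG := growthBound_nonneg (x₀ := x₀) hA hc0
  have hL := hA.L_nonneg
  have hh := hA.h_nonneg x₀
  have hT := hA.T_pos
  rcases ht.1.eq_or_lt with h0 | h0
  · rw [← h0, hrun.apply_zero, sub_self, norm_zero]
    positivity
  · obtain ⟨i, hi, hti⟩ := exists_mem_Ioc_node hT hrun.pos ⟨h0, ht.2⟩
    have h1 := hrun.norm_apply_sub_iterate_le hA hf hx₀ hε hc0 hc hi hti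
    have h2 := hrun.norm_iterate_sub_le hA hf hx₀ hε hc0 hc hi.le
    have e : x t - x₀ = (x t - X i) + (X i - x₀) := by abel
    rw [e]
    refine (norm_add_le _ _).trans (add_le_add (h1.trans ?_) h2)
    gcongr
    exact step_le hT hrun.pos

/-- As soon as the time step is so small that the points to be projected are at distance at most
`ρ / 2` from the moving set, a run of the algorithm is an approximate solution. The normal is that
at the exact projection, and the error comes from the distance between the exact and the
approximate projection. -/
theorem IsCatchingUpRun.exists_hasVelocity [CompleteSpace H]
    (hrun : IsCatchingUpRun T C f ε x₀ n X x)
    (hA : StandingAssumptions T L ρ C F h Lh k) (hf : IsMeasurableSelection T F γ f)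
    (hx₀ : x₀ ∈ C 0) (hε : 0 ≤ ε) (hc0 : 0 ≤ c) (hc : √ε ≤ c * step T n) {M : ℝ}
    (hM : M = 2 * growthBound T L h Lh x₀ c + L + c)
    (hsmall : step T n * M * (ρ⁻¹).toReal ≤ 1 / 2) :
    ∃ v e g : ℝ → H, HasVelocity T (ρ⁻¹).toReal C F M ((3 * M + 1) * step T n + 2 * √ε)
      (2 * (√ε / step T n)) x v e g := by
  have hT := hA.T_pos
  have hn := hrun.pos
  have hμ := step_pos hT hn
  have hG := growthBound_nonneg (x₀ := x₀) hA hc0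
  have hL := hA.L_nonneg
  have hM0 : 0 ≤ M := by rw [hM]; positivity
  have hr0 : 0 ≤ (ρ⁻¹).toReal := ENNReal.toReal_nonneg
  set z : ℕ → H := fun i => X i + ∫ s in (node T n i)..(node T n (i + 1)), f s (X i) with hz
  have hdist : ∀ i < n, Metric.infDist (z i) (C (node T n (i + 1))) ≤ step T n * M := by
    intro i hi
    refine (hrun.infDist_le hA hf hx₀ hi).trans ?_
    have := hrun.h_iterate_le hA hf hx₀ hε hc0 hc hi.le
    refine mul_le_mul_of_nonneg_left ?_ hμ.le
    linarith
  have hds : ∀ i < n, Metric.infDist (z i) (C (node T n (i + 1))) * (ρ⁻¹).toReal ≤ 1 / 2 :=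
    fun i hi => (mul_le_mul_of_nonneg_right (hdist i hi) hr0).trans hsmall
  have hch : ∀ i, ∃ p, i < n → p ∈ C (node T n (i + 1)) ∧
      ‖z i - p‖ = Metric.infDist (z i) (C (node T n (i + 1))) := by
    intro i
    by_cases hi : i < n
    · have hi1 := node_mem_Icc hT hn hi
      obtain ⟨p, hp, e⟩ := (hA.prox _ hi1).exists_nearest (hA.nonempty _ hi1) (hds i hi)
      exact ⟨p, fun _ => ⟨hp, e⟩⟩
    · exact ⟨0, fun h => absurd h hi⟩
  choose p hp using hch
  set V : ℕ → ℝ → H := fun i _ => (step T n)⁻¹ • (z i - p i) with hV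
  set E : ℕ → ℝ → H := fun i _ => (step T n)⁻¹ • (X (i + 1) - p i) with hE
  set G : ℕ → ℝ → H := fun i s => f s (X i) with hGdef
  have hfint : ∀ i < n, IntervalIntegrable (G i) volume (node T n i) (node T n (i + 1)) :=
    fun i hi => hA.intervalIntegrable_selection hf (X i) (node_mem_Icc hT hn hi.le)
      (node_mem_Icc hT hn hi)
  have hWint : ∀ i < n, IntervalIntegrable (fun s => -V i s + E i s + G i s) volume
      (node T n i) (node T n (i + 1)) := fun i hi =>
    (intervalIntegrable_const.neg.add intervalIntegrable_const).add (hfint i hi)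
  -- in the sum the exact projection cancels: only the approximate one enters the velocity
  have hVE : ∀ i s, -V i s + E i s = (step T n)⁻¹ • (X (i + 1) - z i) := fun i s => by
    simp only [hV, hE]; module
  have hWi : ∀ i < n, ∀ t ∈ Icc (node T n i) (node T n (i + 1)),
      ∫ s in (node T n i)..t, (-V i s + E i s + G i s) =
        ((t - node T n i) / step T n) • (X (i + 1) - z i)
          + ∫ s in (node T n i)..t, f s (X i) := by
    intro i hi t ht
    simp only [hVE]
    rw [intervalIntegral.integral_add intervalIntegrable_const
      (hA.intervalIntegrable_selection hf (X i) (node_mem_Icc hT hn hi.le)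
        ⟨(node_mem_Icc hT hn hi.le).1.trans ht.1, ht.2.trans (node_mem_Icc hT hn hi).2⟩),
      intervalIntegral.integral_const, smul_smul, div_eq_mul_inv]
  have e1 : ∀ i, X (i + 1) - z i
      = X (i + 1) - X i - ∫ s in (node T n i)..(node T n (i + 1)), f s (X i) := fun i => by
    simp only [hz]; abel
  have hle : ∀ i, node T n i ≤ node T n (i + 1) := fun i => by
    rw [node_succ]; linarith
  refine ⟨piecewiseOnPartition T n V, piecewiseOnPartition T n E, piecewiseOnPartition T n G,
    integrableOn_piecewiseOnPartition hT hn fun i _ => intervalIntegrable_const,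
    integrableOn_piecewiseOnPartition hT hn fun i _ => intervalIntegrable_const,
    integrableOn_piecewiseOnPartition hT hn hfint, ?_, ?_⟩
  · intro t ht
    refine eq_add_integral_piecewiseOnPartition (G := fun i s => -V i s + E i s + G i s) hT hn
      hWint (X := X) (by rw [hrun.apply_zero, hrun.iterate_zero]) ?_ ?_ ht
    · intro i hi
      rw [hWi i hi _ ⟨hle i, le_rfl⟩]
      have e : (node T n (i + 1) - node T n i) / step T n = 1 := by
        rw [node_succ, add_sub_cancel_left, div_self hμ.ne']
      rw [e, one_smul]
      simp only [hz]; abel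
    · intro i hi t ht
      rw [hWi i hi t ⟨ht.1.le, ht.2⟩, hrun.apply_Ioc i hi t ht, e1, add_assoc]
  · have h0 : ∀ᵐ t : ℝ, t ≠ 0 := by simp [ae_iff, measure_singleton]
    filter_upwards [ae_restrict_of_ae h0, hA.ae_norm_selection_le hf,
      ae_restrict_mem measurableSet_Icc] with t h0 hft ht
    obtain ⟨i, hi, hti⟩ := exists_mem_Ioc_node hT hn ⟨lt_of_le_of_ne ht.1 h0.symm, ht.2⟩
    rw [piecewiseOnPartition_eq hT hn V hti, piecewiseOnPartition_eq hT hn E hti,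
      piecewiseOnPartition_eq hT hn G hti]
    have hi1 := node_mem_Icc hT hn hi
    have hpi := hp i hi
    have hxX := hrun.norm_apply_sub_iterate_le hA hf hx₀ hε hc0 hc hi hti
    have hXX := hrun.norm_iterate_succ_sub_le hA hf hx₀ hε hc hi
    have hhX := hrun.h_iterate_le hA hf hx₀ hε hc0 hc hi.le
    have hXX' : ‖X (i + 1) - X i‖ ≤ M * step T n := by
      refine hXX.trans ?_
      rw [mul_comm M]
      refine mul_le_mul_of_nonneg_left ?_ hμ.le
      linarith
    rw [← hM] at hxX
    have hXp : ‖X (i + 1) - p i‖ ≤ 2 * √ε := by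
      have h1 := (hA.prox _ hi1).norm_sub_sq_le_of_mem_approxProj (hds i hi) hpi.1 hpi.2
        (hrun.iterate_succ i hi)
      refine abs_le_of_sq_le_sq' ?_ (by positivity) |>.2
      rw [mul_pow, Real.sq_sqrt hε]; linarith
    have hsq := Real.sqrt_nonneg ε
    have hMμ : 0 ≤ M * step T n := by positivity
    refine ⟨p i, X i, node T n (i + 1), hi1, ?_, ?_, ?_, (hf.1 t ht _).1, ?_, ?_, ?_, ?_⟩
    · rw [abs_of_nonneg (by linarith [hti.2])]
      have := hti.1
      rw [node_succ]
      linarith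
    · have e : p i - x t = -(X (i + 1) - p i) + (X (i + 1) - X i) + -(x t - X i) := by abel
      rw [e]
      refine norm_add₃_le.trans ?_
      rw [norm_neg, norm_neg]
      linarith
    · exact (hA.prox _ hi1).sub_mem_regularNormalCone hpi.1 hpi.2 (inv_nonneg.2 hμ.le)
    · rw [norm_sub_rev]; linarith
    · rw [hV, norm_smul, norm_inv, Real.norm_of_nonneg hμ.le, hpi.2, inv_mul_le_iff₀ hμ]
      exact hdist i hi
    · refine (hft _).trans ?_
      linarith
    · rw [hE, norm_smul, norm_inv, Real.norm_of_nonneg hμ.le, inv_mul_le_iff₀ hμ]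
      refine hXp.trans (le_of_eq ?_)
      field_simp

end Run

/-! ### Weak limits in `L²` of bounded sequences of functions -/

/-- A pointwise closed convex constraint passes to weak limits in `L²`, because the functions that
satisfy it form a closed convex set. -/
theorem ae_mem_of_tendsto_inner [CompleteSpace H] {α : Type*} [MeasurableSpace α] {μ : Measure α}
    {U : Ultrafilter ℕ} {u : ℕ → Lp H 2 μ} {w : Lp H 2 μ}
    (hw : ∀ y : Lp H 2 μ, Tendsto (fun n => inner ℝ (u n) y) U (𝓝 (inner ℝ w y)))
    {Φ : α → Set H} (hcl : ∀ t, IsClosed (Φ t)) (hconv : ∀ t, Convex ℝ (Φ t))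
    (hu : ∀ᶠ n in (U : Filter ℕ), ∀ᵐ t ∂μ, u n t ∈ Φ t) : ∀ᵐ t ∂μ, w t ∈ Φ t := by
  set K : Set (Lp H 2 μ) := {w | ∀ᵐ t ∂μ, w t ∈ Φ t} with hK
  have hKconv : Convex ℝ K := by
    intro a ha b hb s r hs hr hsr
    change ∀ᵐ t ∂μ, _
    filter_upwards [ha, hb, Lp.coeFn_add (s • a) (r • b), Lp.coeFn_smul s a, Lp.coeFn_smul r b]
      with t hat hbt h1 h2 h3
    rw [h1, Pi.add_apply, h2, h3]
    exact hconv t hat hbt hs hr hsr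
  have hKcl : IsClosed K := by
    refine IsSeqClosed.isClosed fun a b ha hab => ?_
    obtain ⟨ns, -, hns⟩ := (tendstoInMeasure_of_tendsto_Lp hab).exists_seq_tendsto_ae
    change ∀ᵐ t ∂μ, _
    filter_upwards [hns, ae_all_iff.2 fun n => ha n] with t ht hat
    exact (hcl t).mem_of_tendsto ht (Eventually.of_forall fun n => hat _)
  by_contra hwK
  obtain ⟨φ, c, h1, h2⟩ := geometric_hahn_banach_point_closed hKconv hKcl (x := w) hwK
  have h3 : Tendsto (fun n => φ (u n)) U (𝓝 (φ w)) := by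
    have e : ∀ b, φ b = inner ℝ b ((InnerProductSpace.toDual ℝ _).symm φ) := fun b => by
      rw [real_inner_comm, InnerProductSpace.toDual_symm_apply]
    simp only [e]
    exact hw _
  exact absurd (ge_of_tendsto h3 (hu.mono fun n hn => (h2 _ hn).le)) (not_le.2 h1)

/-- A bounded sequence of functions on a finite measure space has, along an ultrafilter, a limit in
the weak topology of `L²`; almost everywhere its values lie in the closed convex hulls of the tails
of the sequence. -/
theorem exists_weak_limit [CompleteSpace H] {α : Type*} [MeasurableSpace α] {μ : Measure α}
    [IsFiniteMeasure μ] {U : Ultrafilter ℕ} (hU : (U : Filter ℕ) ≤ atTop) {g : ℕ → α → H} {M : ℝ}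
    (hM : 0 ≤ M) (hg : ∀ n, AEStronglyMeasurable (g n) μ) (hgM : ∀ n, ∀ᵐ t ∂μ, ‖g n t‖ ≤ M) :
    ∃ w : α → H, Integrable w μ ∧
      (∀ᵐ t ∂μ, ∀ N, w t ∈ closedConvexHull ℝ ((fun n => g n t) '' Ici N)) ∧
      ∀ s, MeasurableSet s → ∀ c : H, Tendsto (fun n => inner ℝ c (∫ t in s, g n t ∂μ)) U
        (𝓝 (inner ℝ c (∫ t in s, w t ∂μ))) := by
  have hmem : ∀ n, MemLp (g n) 2 μ := fun n => MemLp.of_bound (hg n) M (hgM n)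
  set u : ℕ → Lp H 2 μ := fun n => (hmem n).toLp with hu
  have hug : ∀ n, u n =ᵐ[μ] g n := fun n => (hmem n).coeFn_toLp
  have hub : ∀ n, ‖u n‖ ≤ measureUnivNNReal μ ^ (2 : ℝ≥0∞).toReal⁻¹ * M := fun n =>
    Lp.norm_le_of_ae_bound hM (by filter_upwards [hug n, hgM n] with t h1 h2; rwa [h1])
  obtain ⟨w, hw⟩ := U.exists_tendsto_inner (Eventually.of_forall hub)
  refine ⟨w, (Lp.memLp w).integrable (by norm_num), ae_all_iff.2 fun N => ?_, ?_⟩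
  · refine ae_mem_of_tendsto_inner hw (fun _ => isClosed_closedConvexHull)
      (fun _ => convex_closedConvexHull) ?_
    filter_upwards [hU (Ici_mem_atTop N)] with n hn
    filter_upwards [hug n] with t ht
    rw [ht]
    exact subset_closedConvexHull ⟨n, hn, rfl⟩
  · intro s hs c
    have h1 := hw (indicatorConstLp 2 hs (measure_ne_top μ s) c)
    simp only [real_inner_comm (indicatorConstLp 2 hs (measure_ne_top μ s) c)] at h1
    rw [L2.inner_indicatorConstLp_eq_inner_setIntegral] at h1
    refine h1.congr fun n => ?_
    rw [L2.inner_indicatorConstLp_eq_inner_setIntegral,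
      integral_congr_ae (ae_restrict_of_ae (hug n))]

/-! ### Identification of the limits -/

theorem le_of_mem_closedConvexHull_tails {E : Type*} [NormedAddCommGroup E] [NormedSpace ℝ E]
    {w : ℕ → E} {z : E} (hz : ∀ N, z ∈ closedConvexHull ℝ (w '' Ici N)) (φ : StrongDual ℝ E)
    {c : ℝ} (h : ∀ᶠ n in atTop, φ (w n) ≤ c) : φ z ≤ c := by
  obtain ⟨N, hN⟩ := eventually_atTop.1 h
  have h1 : closedConvexHull ℝ (w '' Ici N) ⊆ {y | φ y ≤ c} :=
    closedConvexHull_min (by rintro _ ⟨n, hn, rfl⟩; exact hN n hn)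
      (convex_halfSpace_le φ.toLinearMap.isLinear c) (isClosed_le φ.continuous continuous_const)
  exact h1 (hz N)

/-- Closedness of the graph of the perturbation, for the strong topology in the argument and the
convexified weak convergence of the values. -/
theorem UpperSemicontinuousWeak.mem_of_mem_closedConvexHull {G : H → Set H}
    (hG : UpperSemicontinuousWeak G) {x z : H} (hcl : IsClosed (G x)) (hconv : Convex ℝ (G x))
    {a w : ℕ → H} (ha : Tendsto a atTop (𝓝 x)) (hw : ∀ n, w n ∈ G (a n))
    (hz : ∀ N, z ∈ closedConvexHull ℝ (w '' Ici N)) : z ∈ G x := by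
  by_contra hzG
  obtain ⟨φ, c, h1, h2⟩ := geometric_hahn_banach_closed_point hconv hcl hzG
  have hA : IsClosed (toWeakSpace ℝ H '' {y | c ≤ φ y}) := by
    have hAc : Convex ℝ {y | c ≤ φ y} := convex_halfSpace_ge φ.toLinearMap.isLinear c
    have hAcl : IsClosed {y | c ≤ φ y} := isClosed_le continuous_const φ.continuous
    have := hAc.toWeakSpace_closure (𝕜 := ℝ)
    rw [hAcl.closure_eq] at this
    rw [this]
    exact isClosed_closure
  have hx : x ∈ {x | (G x ∩ {y | c ≤ φ y}).Nonempty}ᶜ := by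
    rintro ⟨y, hy, hcy⟩
    exact absurd (h1 y hy) (not_lt.2 hcy)
  have hev := ha.eventually ((hG _ hA).isOpen_compl.mem_nhds hx)
  have := le_of_mem_closedConvexHull_tails hz φ (c := c) (hev.mono fun n hn => by
    by_contra hlt
    exact hn ⟨w n, hw n, (not_le.1 hlt).le⟩)
  linarith

section Existence

variable {T L : ℝ} {ρ : ℝ≥0∞} {C : ℝ → Set H} {F : ℝ → H → Set H} {h : H → ℝ} {Lh : ℝ≥0}
  {k : ℝ → ℝ}

/-- Closedness of the graph of the normal cone along the moving set. -/
theorem StandingAssumptions.mem_clarkeNormalCone_of_mem_closedConvexHull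
    (hA : StandingAssumptions T L ρ C F h Lh k) {t : ℝ} (ht : t ∈ Icc 0 T) {x z : H} {M r : ℝ}
    (hr : 0 ≤ r) {θ : ℕ → ℝ} {p v : ℕ → H} (hθT : ∀ n, θ n ∈ Icc 0 T)
    (hθ : Tendsto θ atTop (𝓝 t)) (hp : Tendsto p atTop (𝓝 x))
    (hv : ∀ n, v n ∈ regularNormalCone r (C (θ n)) (p n)) (hvM : ∀ n, ‖v n‖ ≤ M)
    (hz : ∀ N, z ∈ closedConvexHull ℝ (v '' Ici N)) : z ∈ clarkeNormalCone (C t) x := by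
  have hθ0 : Tendsto (fun n => L * |t - θ n|) atTop (𝓝 0) := by
    simpa using ((tendsto_const_nhds (x := t)).sub hθ).abs.const_mul L
  have hx : x ∈ C t := by
    choose q hq hqp using fun n => hA.near t ht (θ n) (hθT n) (p n) (hv n).1
    have h1 : Tendsto (fun n => q n - p n) atTop (𝓝 0) := squeeze_zero_norm hqp hθ0
    have h2 : Tendsto q atTop (𝓝 x) := by simpa using h1.add hp
    exact (hA.prox t ht).1.mem_of_tendsto h2 (Eventually.of_forall hq)
  refine mem_clarkeNormalCone (σ := M / 2 * r) hx fun x' hx' => ?_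
  choose q hq hqx using fun n => hA.near (θ n) (hθT n) t ht x' hx'
  have hq' : Tendsto q atTop (𝓝 x') := by
    have h1 : Tendsto (fun n => q n - x') atTop (𝓝 0) :=
      squeeze_zero_norm (fun n => (hqx n).trans_eq (by rw [abs_sub_comm])) hθ0
    simpa using h1.add_const x'
  have hM0 : 0 ≤ M := (norm_nonneg _).trans (hvM 0)
  have hlim : Tendsto (fun n => M / 2 * r * ‖q n - p n‖ ^ 2 + M * ‖(x' - x) - (q n - p n)‖) atTop
      (𝓝 (M / 2 * r * ‖x' - x‖ ^ 2)) := by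
    have h1 := hq'.sub hp
    have h2 := ((h1.norm.pow 2).const_mul (M / 2 * r)).add
      (((tendsto_const_nhds (x := x' - x)).sub h1).norm.const_mul M)
    simpa using h2
  have hle : ∀ n, inner ℝ (v n) (x' - x) ≤
      M / 2 * r * ‖q n - p n‖ ^ 2 + M * ‖(x' - x) - (q n - p n)‖ := by
    intro n
    have e : x' - x = (q n - p n) + ((x' - x) - (q n - p n)) := by abel
    nth_rewrite 1 [e]
    rw [inner_add_right]
    refine add_le_add (((hv n).2 _ (hq n)).trans ?_) ((real_inner_le_norm _ _).trans ?_)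
    · gcongr
      exact hvM n
    · gcongr
      exact hvM n
  refine le_of_forall_pos_le_add fun ε hε => ?_
  have := le_of_mem_closedConvexHull_tails hz (innerSL ℝ (x' - x))
    (c := M / 2 * r * ‖x' - x‖ ^ 2 + ε) (by
      filter_upwards [hlim.eventually_lt_const (lt_add_of_pos_right _ hε)] with n hn
      rw [innerSL_apply_apply, real_inner_comm]
      exact (hle n).trans hn.le)
  rwa [innerSL_apply_apply, real_inner_comm] at this

theorem setIntegral_restrict_Icc_eq {T t : ℝ} (ht : t ∈ Icc 0 T) (w : ℝ → H) :
    ∫ s in Ioc 0 t, w s ∂(volume.restrict (Icc 0 T)) = ∫ s in (0 : ℝ)..t, w s := by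
  rw [Measure.restrict_restrict measurableSet_Ioc,
    inter_eq_self_of_subset_left (Ioc_subset_Icc_self.trans (Icc_subset_Icc_right ht.2)),
    intervalIntegral.integral_of_le ht.1]

/-- Approximate solutions whose errors tend to zero converge to a solution: by comparison they form
a Cauchy sequence, and their velocities converge weakly in `L²`. -/
theorem StandingAssumptions.exists_isSolution_of_hasVelocity [CompleteSpace H]
    (hA : StandingAssumptions T L ρ C F h Lh k) {M : ℝ} (hM : 0 ≤ M) {x₀ : H} {δ η : ℕ → ℝ}
    (hδ0 : ∀ n, 0 ≤ δ n) (hη0 : ∀ n, 0 ≤ η n) (hδ1 : ∀ n, δ n ≤ 1) (hη1 : ∀ n, η n ≤ 1)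
    (hδ : Tendsto δ atTop (𝓝 0)) (hη : Tendsto η atTop (𝓝 0)) {y v e g : ℕ → ℝ → H}
    (hy0 : ∀ n, y n 0 = x₀)
    (hy : ∀ n, HasVelocity T (ρ⁻¹).toReal C F M (δ n) (η n) (y n) (v n) (e n) (g n)) :
    ∃ x, IsSolution T C F x₀ x := by
  have hT := hA.T_pos
  have hconst : IntegrableOn (fun _ : ℝ => M) (Icc 0 T) := by simp
  -- pointwise convergence
  obtain ⟨K, hK0, hK⟩ := hA.exists_comparison hconst hconst (fun _ _ => hM) (fun _ _ => hM)
  have hcauchy : ∀ t ∈ Icc 0 T, ∃ z, Tendsto (fun n => y n t) atTop (𝓝 z) := by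
    intro t ht
    refine cauchySeq_tendsto_of_complete (Metric.cauchySeq_iff'.2 fun ε hε => ?_)
    have hl : Tendsto (fun n => K * (δ n + η n)) atTop (𝓝 0) := by
      simpa using (hδ.add hη).const_mul K
    obtain ⟨N, hN⟩ := eventually_atTop.1
      (hl.eventually_lt_const (by positivity : (0 : ℝ) < ε ^ 2 / 2))
    refine ⟨N, fun n hn => ?_⟩
    have h1 := hK (δ n) (δ N) (η n) (η N) (y n) (y N) (hδ0 n) (hδ0 N) (hη0 n) (hη0 N) (hδ1 n)
      (hδ1 N) (hη1 n) (hη1 N) ((hy n).isApproxSolution hT.le hM (hη0 n))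
      ((hy N).isApproxSolution hT.le hM (hη0 N)) ((hy0 n).trans (hy0 N).symm) t ht
    have h2 := hN n hn
    have h3 := hN N le_rfl
    rw [dist_eq_norm]
    refine abs_lt_of_sq_lt_sq' ?_ hε.le |>.2
    linarith
  -- weak convergence of the velocities
  set μ := volume.restrict (Icc (0 : ℝ) T) with hμ
  obtain ⟨U, hU⟩ : ∃ U : Ultrafilter ℕ, (U : Filter ℕ) ≤ atTop :=
    ⟨hyperfilter ℕ, Nat.hyperfilter_le_atTop⟩
  obtain ⟨V, hVint, hVmem, hVlim⟩ := exists_weak_limit (μ := μ) hU hM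
    (fun n => (hy n).integrable_v.aestronglyMeasurable) fun n => by
      filter_upwards [(hy n).inclusion] with t ⟨p, a, θ, _, _, _, _, _, _, h1, h2, h3⟩ using h1
  obtain ⟨G, hGint, hGmem, hGlim⟩ := exists_weak_limit (μ := μ) hU hM
    (fun n => (hy n).integrable_g.aestronglyMeasurable) fun n => by
      filter_upwards [(hy n).inclusion] with t ⟨p, a, θ, _, _, _, _, _, _, h1, h2, h3⟩ using h2
  set x : ℝ → H := fun t => x₀ + ∫ s in (0 : ℝ)..t, (-V s + G s) with hx
  have hx0 : x 0 = x₀ := by simp [hx]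
  have hsub : ∀ w : ℝ → H, IntegrableOn w (Icc 0 T) → ∀ t ∈ Icc 0 T,
      IntervalIntegrable w volume 0 t := fun w hw t ht =>
    ((intervalIntegrable_iff_integrableOn_Icc_of_le hT.le).2 hw).mono_set (by
      rw [uIcc_of_le ht.1, uIcc_of_le hT.le]; exact Icc_subset_Icc_right ht.2)
  have hlim : ∀ t ∈ Icc 0 T, Tendsto (fun n => y n t) atTop (𝓝 (x t)) := by
    intro t ht
    obtain ⟨z, hz⟩ := hcauchy t ht
    have he : Tendsto (fun n => ∫ s in (0 : ℝ)..t, e n s) atTop (𝓝 0) := by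
      refine squeeze_zero_norm (a := fun n => η n * |t - 0|) (fun n => ?_) ?_
      · refine intervalIntegral.norm_integral_le_of_norm_le_const_ae ?_
        have := (hy n).inclusion
        rw [ae_restrict_iff' measurableSet_Icc] at this
        filter_upwards [this] with s hs hs'
        rw [uIoc_of_le ht.1] at hs'
        obtain ⟨p, a, θ, _, _, _, _, _, _, h1, h2, h3⟩ := hs ⟨hs'.1.le, hs'.2.trans ht.2⟩
        exact h3
      · simpa using hη.mul_const |t - 0|
    have : z = x t := by
      refine ext_inner_left ℝ fun c => ?_
      have l1 : Tendsto (fun n => inner ℝ c (y n t)) U (𝓝 (inner ℝ c z)) :=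
        tendsto_const_nhds.inner (hz.mono_left hU)
      have l2 : Tendsto (fun n => inner ℝ c x₀ + (-inner ℝ c (∫ s in (0 : ℝ)..t, v n s)
          + inner ℝ c (∫ s in (0 : ℝ)..t, e n s) + inner ℝ c (∫ s in (0 : ℝ)..t, g n s))) U
          (𝓝 (inner ℝ c x₀ + (-inner ℝ c (∫ s in (0 : ℝ)..t, V s) + inner ℝ c 0
            + inner ℝ c (∫ s in (0 : ℝ)..t, G s)))) := by
        have hV := hVlim (Ioc 0 t) measurableSet_Ioc c
        have hG := hGlim (Ioc 0 t) measurableSet_Ioc c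
        simp only [hμ, setIntegral_restrict_Icc_eq ht] at hV hG
        exact tendsto_const_nhds.add
          ((hV.neg.add (tendsto_const_nhds.inner (he.mono_left hU))).add hG)
      have e1 : ∀ n, inner ℝ c (y n t) = inner ℝ c x₀ + (-inner ℝ c (∫ s in (0 : ℝ)..t, v n s)
          + inner ℝ c (∫ s in (0 : ℝ)..t, e n s) + inner ℝ c (∫ s in (0 : ℝ)..t, g n s)) := by
        intro n
        have i1 : IntervalIntegrable (fun s => -v n s) volume 0 t :=
          (hsub _ (hy n).integrable_v t ht).neg
        have i2 := hsub _ (hy n).integrable_e t ht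
        have i3 := hsub _ (hy n).integrable_g t ht
        have i12 : IntervalIntegrable (fun s => -v n s + e n s) volume 0 t := i1.add i2
        rw [(hy n).eq_integral t ht, hy0, intervalIntegral.integral_add i12 i3,
          intervalIntegral.integral_add i1 i2, intervalIntegral.integral_neg, inner_add_right,
          inner_add_right, inner_add_right, inner_neg_right]
      have e2 : inner ℝ c (x t) = inner ℝ c x₀ + (-inner ℝ c (∫ s in (0 : ℝ)..t, V s)
          + inner ℝ c 0 + inner ℝ c (∫ s in (0 : ℝ)..t, G s)) := by
        have i1 : IntervalIntegrable (fun s => -V s) volume 0 t := (hsub _ hVint t ht).neg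
        have i3 := hsub _ hGint t ht
        change inner ℝ c (x₀ + ∫ s in (0 : ℝ)..t, (-V s + G s)) = _
        rw [intervalIntegral.integral_add i1 i3, intervalIntegral.integral_neg,
          inner_add_right, inner_add_right, inner_neg_right, inner_zero_right, add_zero]
      rw [e2]
      exact tendsto_nhds_unique l1 (l2.congr fun n => (e1 n).symm)
    rwa [this] at hz
  have hwint : IntegrableOn (fun s => -V s + G s) (Icc 0 T) :=
    Integrable.add (Integrable.neg hVint) hGint
  have hxeq : ∀ t ∈ Icc 0 T, x t = x 0 + ∫ s in (0 : ℝ)..t, (-V s + G s) := fun t _ => by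
    rw [hx0]
  have hincl := ae_all_iff.2 fun n => (hy n).inclusion
  have hball : ∀ {t : ℝ} {w : ℕ → ℝ → H} {W : H}, (∀ n, ‖w n t‖ ≤ M) →
      (∀ N, W ∈ closedConvexHull ℝ ((fun n => w n t) '' Ici N)) → ‖W‖ ≤ M := by
    intro t w W hw hW
    have h1 : closedConvexHull ℝ ((fun n => w n t) '' Ici 0) ⊆ Metric.closedBall 0 M :=
      closedConvexHull_min (by rintro _ ⟨n, -, rfl⟩; simpa using hw n) (convex_closedBall 0 M)
        Metric.isClosed_closedBall
    simpa using h1 (hW 0)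
  refine ⟨x, ?_, hx0, ?_⟩
  · have hK : ∀ᵐ t ∂(volume.restrict (Icc 0 T)), ‖-V t + G t‖ ≤ (⟨M + M, by positivity⟩ : ℝ≥0) := by
      filter_upwards [hincl, hVmem, hGmem] with t ht hV hG
      choose p a θ _ _ _ _ _ _ h7 h8 _ using ht
      refine (norm_add_le _ _).trans ?_
      rw [norm_neg]
      exact add_le_add (hball h7 hV) (hball h8 hG)
    have := lipschitzOnWith_of_eq_integral hT.le hwint hK hxeq
    rw [← uIcc_of_le hT.le] at this
    exact this.absolutelyContinuousOnInterval
  · filter_upwards [hincl, hVmem, hGmem, ae_hasDerivAt_of_eq_integral hT.le hwint hxeq,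
      ae_restrict_mem measurableSet_Icc] with t hinc hV hG hd ht
    choose p a θ h1 h2 h3 h4 h5 h6 h7 _ _ using hinc
    have hxt := hlim t ht
    have hp : Tendsto p atTop (𝓝 (x t)) := by
      have : Tendsto (fun n => p n - y n t) atTop (𝓝 0) := squeeze_zero_norm h3 hδ
      simpa using this.add hxt
    have ha : Tendsto a atTop (𝓝 (x t)) := by
      have : Tendsto (fun n => a n - y n t) atTop (𝓝 0) := squeeze_zero_norm h6 hδ
      simpa using this.add hxt
    have hθ : Tendsto θ atTop (𝓝 t) := by
      have : Tendsto (fun n => θ n - t) atTop (𝓝 0) := squeeze_zero_norm h2 hδ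
      simpa using this.add_const t
    exact ⟨V t, hA.mem_clarkeNormalCone_of_mem_closedConvexHull ht ENNReal.toReal_nonneg h1 hθ hp
      h4 h7 hV, G t, (hA.F_usc t ht).mem_of_mem_closedConvexHull (hA.F_closed t ht _)
      (hA.F_convex t ht _) ha h5 hG, hd⟩

/-- Existence of a solution, as a limit of the catching-up algorithm with errors `μ_n⁴`. -/
theorem StandingAssumptions.exists_isSolution [CompleteSpace H]
    (hA : StandingAssumptions T L ρ C F h Lh k) {γ : ℝ} {f : ℝ → H → H}
    (hf : IsMeasurableSelection T F γ f) {x₀ : H} (hx₀ : x₀ ∈ C 0) :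
    ∃ x, IsSolution T C F x₀ x := by
  have hT := hA.T_pos
  set M := 2 * growthBound T L h Lh x₀ T + L + T with hM
  have hG := growthBound_nonneg (x₀ := x₀) hA hT.le
  have hL := hA.L_nonneg
  have hM0 : 0 ≤ M := by positivity
  set δ : ℕ → ℝ := fun n => (3 * M + 1) * step T n + 2 * step T n ^ 2 with hδdef
  set η : ℕ → ℝ := fun n => 2 * step T n with hηdef
  have hs := tendsto_step T
  have hδ : Tendsto δ atTop (𝓝 0) := by
    simpa using (hs.const_mul (3 * M + 1)).add ((hs.pow 2).const_mul 2)
  have hη : Tendsto η atTop (𝓝 0) := by simpa using hs.const_mul 2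
  have hsm : Tendsto (fun n => step T n * M * (ρ⁻¹).toReal) atTop (𝓝 0) := by
    simpa using (hs.mul_const M).mul_const (ρ⁻¹).toReal
  obtain ⟨N, hN⟩ := eventually_atTop.1 (((hδ.eventually_lt_const one_pos).and
    (hη.eventually_lt_const one_pos)).and ((hsm.eventually_lt_const
      (by norm_num : (0 : ℝ) < 1 / 2)).and (eventually_ge_atTop 1)))
  -- with `ε = μ⁴` both `√ε ≤ T μ` and `√ε / μ = μ → 0`
  obtain ⟨X, xs, hX⟩ := exists_isCatchingUp hT hA.nonempty f
    (ε := fun n => step T n ^ 4) (fun n hn => pow_pos (step_pos hT hn) 4) x₀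
  have hrun : ∀ j, ∃ v e g, HasVelocity T (ρ⁻¹).toReal C F M (δ (j + N)) (η (j + N))
      (xs (j + N)) v e g := by
    intro j
    obtain ⟨⟨_, _⟩, h3, h4⟩ := hN (j + N) (by omega)
    have hμ := step_pos hT h4
    have hsq : √(step T (j + N) ^ 4) = step T (j + N) ^ 2 := by
      rw [show step T (j + N) ^ 4 = (step T (j + N) ^ 2) ^ 2 by ring,
        Real.sqrt_sq (by positivity)]
    obtain ⟨v, e, g, hv⟩ := (hX.run h4).exists_hasVelocity hA hf hx₀ (by positivity) hT.le (by
      rw [hsq, pow_two]; gcongr; exact step_le hT h4) hM h3.le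
    refine ⟨v, e, g, ?_⟩
    have e1 : 2 * (√(step T (j + N) ^ 4) / step T (j + N)) = η (j + N) := by
      rw [hsq, hηdef]; field_simp
    rw [e1, hsq] at hv
    exact hv
  choose v e g hv using hrun
  refine hA.exists_isSolution_of_hasVelocity (x₀ := x₀) hM0 (fun n => ?_) (fun n => ?_)
    (fun n => (hN (n + N) (by omega)).1.1.le) (fun n => (hN (n + N) (by omega)).1.2.le)
    ((tendsto_add_atTop_iff_nat N).2 hδ) ((tendsto_add_atTop_iff_nat N).2 hη)
    (fun n => hX.apply_zero _ (hN (n + N) (by omega)).2.2) hv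
  · have := step_pos hT (hN (n + N) (by omega)).2.2
    simp only [hδdef]; positivity
  · have := step_pos hT (hN (n + N) (by omega)).2.2
    simp only [hηdef]; positivity

end Existence

/-! ### The rate of convergence -/

section Rate

variable {T L : ℝ} {ρ : ℝ≥0∞} {C : ℝ → Set H} {F : ℝ → H → Set H} {h : H → ℝ} {Lh : ℝ≥0}
  {k : ℝ → ℝ}

theorem tendsto_rate {ε : ℕ → ℝ} (hε : ∀ n, 1 ≤ n → 0 < ε n) (hT : 0 < T)
    (hlim : Tendsto (fun n => ε n / step T n ^ 2) atTop (𝓝 0)) :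
    Tendsto (fun n => √(ε n) / step T n) atTop (𝓝 0) ∧ Tendsto (fun n => √(ε n)) atTop (𝓝 0) := by
  have h1 : Tendsto (fun n => √(ε n) / step T n) atTop (𝓝 0) := by
    have h0 := hlim.sqrt
    rw [Real.sqrt_zero] at h0
    refine h0.congr' ?_
    filter_upwards [eventually_ge_atTop 1] with n hn
    rw [Real.sqrt_div (hε n hn).le, Real.sqrt_sq (step_pos hT hn).le]
  refine ⟨h1, ?_⟩
  have h2 := h1.mul (tendsto_step T)
  rw [mul_zero] at h2
  refine h2.congr' ?_
  filter_upwards [eventually_ge_atTop 1] with n hn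
  exact div_mul_cancel₀ _ (step_pos hT hn).ne'

theorem exists_sqrt_le_mul_step {ε : ℕ → ℝ} (hT : 0 < T)
    (hlim : Tendsto (fun n => ε n / step T n ^ 2) atTop (𝓝 0)) :
    ∃ c : ℝ, 0 ≤ c ∧ ∀ n, 1 ≤ n → √(ε n) ≤ c * step T n := by
  obtain ⟨B, hB⟩ := hlim.bddAbove_range
  refine ⟨√(max B 0), Real.sqrt_nonneg _, fun n hn => ?_⟩
  have hμ := step_pos hT hn
  have h1 : ε n / step T n ^ 2 ≤ max B 0 := (hB ⟨n, rfl⟩).trans (le_max_left _ _)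
  rw [div_le_iff₀ (by positivity)] at h1
  refine (Real.sqrt_le_sqrt h1).trans_eq ?_
  rw [Real.sqrt_mul (le_max_right _ _), Real.sqrt_sq hμ.le]

/-- The error estimate, with a constant that does not depend on the run. -/
theorem StandingAssumptions.exists_rate [CompleteSpace H]
    (hA : StandingAssumptions T L ρ C F h Lh k) {γ : ℝ} {x₀ : H} (hx₀ : x₀ ∈ C 0) {x : ℝ → H}
    (hx : IsSolution T C F x₀ x) {ε : ℕ → ℝ} (hε : ∀ n, 1 ≤ n → 0 < ε n)
    (hlim : Tendsto (fun n => ε n / step T n ^ 2) atTop (𝓝 0)) :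
    ∃ D : ℝ, 0 ≤ D ∧ ∀ f : ℝ → H → H, IsMeasurableSelection T F γ f →
      ∀ (X : ℕ → ℕ → H) (xs : ℕ → ℝ → H), IsCatchingUp T C f ε x₀ X xs →
        ∀ n, 1 ≤ n → ∀ t ∈ Icc 0 T,
          ‖xs n t - x t‖ ^ 2 ≤ D * (√(ε n) + step T n + √(ε n) / step T n) := by
  have hT := hA.T_pos
  obtain ⟨c, hc0, hc⟩ := exists_sqrt_le_mul_step hT hlim
  obtain ⟨hq, hsq⟩ := tendsto_rate hε hT hlim
  have hs := tendsto_step T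
  set M := 2 * growthBound T L h Lh x₀ c + L + c with hM
  have hG := growthBound_nonneg (x₀ := x₀) hA hc0
  have hL := hA.L_nonneg
  have hM0 : 0 ≤ M := by positivity
  obtain ⟨m, hm, hm0, hxm⟩ := hA.exists_bound_isApproxSolution hx
  obtain ⟨K, hK0, hK⟩ := hA.exists_comparison (m₁ := fun _ => M) (by simp) hm
    (fun _ _ => hM0) hm0
  have hδ : Tendsto (fun n => (3 * M + 1) * step T n + 2 * √(ε n)) atTop (𝓝 0) := by
    simpa using (hs.const_mul (3 * M + 1)).add (hsq.const_mul 2)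
  have hη : Tendsto (fun n => 2 * (√(ε n) / step T n)) atTop (𝓝 0) := by
    simpa using hq.const_mul 2
  have hsm : Tendsto (fun n => step T n * M * (ρ⁻¹).toReal) atTop (𝓝 0) := by
    simpa using (hs.mul_const M).mul_const (ρ⁻¹).toReal
  obtain ⟨N, hN⟩ := eventually_atTop.1 (((hδ.eventually_lt_const one_pos).and
    (hη.eventually_lt_const one_pos)).and (hsm.eventually_lt_const
      (by norm_num : (0 : ℝ) < 1 / 2)))
  obtain ⟨R, hR⟩ := hx.absolutelyContinuous.exists_bound
  rw [uIcc_of_le hT.le] at hR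
  set R' := 2 * M * T + T * (2 * h x₀ + L + c) * Real.exp (2 * Lh * T) with hR'
  have hRR : 0 ≤ R' + ‖x₀‖ + R := by
    have := hA.h_nonneg x₀
    have := (norm_nonneg _).trans (hR 0 ⟨le_rfl, hT.le⟩)
    positivity
  refine ⟨K * (3 * M + 3) + (R' + ‖x₀‖ + R) ^ 2 * (N / T), by positivity, ?_⟩
  intro f hf X xs hX n hn t ht
  have hμ := step_pos hT hn
  have hrun := hX.run hn
  have hεn := (hε n hn).le
  have hr0 := Real.sqrt_nonneg (ε n)
  have hq0 : 0 ≤ √(ε n) / step T n := by positivity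
  set S := √(ε n) + step T n + √(ε n) / step T n with hS
  have hS0 : 0 ≤ S := by positivity
  rw [add_mul]
  rcases le_or_gt N n with hNn | hNn
  · obtain ⟨⟨h1, h2⟩, h3⟩ := hN n hNn
    obtain ⟨v, e, g, hv⟩ := hrun.exists_hasVelocity hA hf hx₀ hεn hc0 (hc n hn) hM h3.le
    have h4 := hK _ 0 _ 0 _ x (by positivity) le_rfl (by positivity) le_rfl h1.le zero_le_one h2.le
      zero_le_one (hv.isApproxSolution hT.le hM0 (by positivity)) hxm
      (hrun.apply_zero.trans hx.initial.symm) t ht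
    have h5 : (3 * M + 1) * step T n + 2 * √(ε n) + 0 + (2 * (√(ε n) / step T n) + 0)
        ≤ (3 * M + 3) * S := by
      have := mul_nonneg hM0 hr0
      have := mul_nonneg hM0 hq0
      rw [hS]
      linarith
    have h6 := mul_le_mul_of_nonneg_left h5 hK0
    have h7 : 0 ≤ (R' + ‖x₀‖ + R) ^ 2 * (N / T) * S := by positivity
    linarith
  · -- for the finitely many coarse partitions, an a priori bound is enough, since `μ_n ≥ T / N`
    have h1 := hrun.norm_apply_sub_le hA hf hx₀ hεn hc0 (hc n hn) ht
    have h2 : ‖xs n t - x t‖ ≤ R' + ‖x₀‖ + R := by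
      have e : xs n t - x t = (xs n t - x₀) + x₀ + -x t := by abel
      rw [e]
      refine norm_add₃_le.trans ?_
      rw [norm_neg]
      exact add_le_add (add_le_add h1 le_rfl) (hR t ht)
    have h3 : 1 ≤ N / T * S := by
      have h4 : (1 : ℝ) ≤ N / n := by
        rw [le_div_iff₀ (by exact_mod_cast hn), one_mul]; exact_mod_cast hNn.le
      have h5 : (N : ℝ) / n = N / T * step T n := by
        unfold step; field_simp
      rw [h5] at h4
      refine h4.trans ?_
      gcongr
      rw [hS]; linarith
    have h4 : ‖xs n t - x t‖ ^ 2 ≤ (R' + ‖x₀‖ + R) ^ 2 := by gcongr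
    have h5 : (R' + ‖x₀‖ + R) ^ 2 * 1 ≤ (R' + ‖x₀‖ + R) ^ 2 * (N / T * S) := by gcongr
    have h6 : 0 ≤ K * (3 * M + 3) * S := by positivity
    linarith

end Rate

theorem tendstoUniformlyOn_of_rate {E : Type*} [NormedAddCommGroup E] {s : Set ℝ}
    {xs : ℕ → ℝ → E} {x : ℝ → E} {b : ℕ → ℝ} (hb : Tendsto b atTop (𝓝 0))
    (h : ∀ n, 1 ≤ n → ∀ t ∈ s, ‖xs n t - x t‖ ^ 2 ≤ b n) : TendstoUniformlyOn xs x atTop s := by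
  rw [Metric.tendstoUniformlyOn_iff]
  intro ε hε
  filter_upwards [hb.eventually_lt_const (by positivity : (0 : ℝ) < ε ^ 2),
    eventually_ge_atTop 1] with n hn hn1 t ht
  rw [dist_comm, dist_eq_norm]
  exact abs_lt_of_sq_lt_sq' ((h n hn1 t ht).trans_lt hn) hε.le |>.2

end SweepingProcess

theorem theorem4p1 {H : Type*} [NormedAddCommGroup H] [InnerProductSpace ℝ H] [CompleteSpace H]
    (T : ℝ) (hT : 0 < T)
    -- the moving set
    (C : ℝ → Set H)
    (hC_nonempty : ∀ t ∈ Icc 0 T, (C t).Nonempty)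
    (hC_closed : ∀ t ∈ Icc 0 T, IsClosed (C t))
    (L_C : ℝ)
    (hC_lip : ∀ t ∈ Icc 0 T, ∀ s ∈ Icc 0 T,
      Metric.hausdorffEDist (C t) (C s) ≤ ENNReal.ofReal (L_C * |t - s|))
    (ρ : ℝ≥0∞) (hρ : 0 < ρ)
    (hC_prox : ∀ t ∈ Icc 0 T, SweepingProcess.UniformlyProxRegular ρ (C t))
    -- the perturbation
    (F : ℝ → H → Set H)
    (hF_nonempty : ∀ t ∈ Icc 0 T, ∀ x, (F t x).Nonempty)
    (hF_closed : ∀ t ∈ Icc 0 T, ∀ x, IsClosed (F t x))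
    (hF_convex : ∀ t ∈ Icc 0 T, ∀ x, Convex ℝ (F t x))
    (hF_usc : ∀ t ∈ Icc 0 T, SweepingProcess.UpperSemicontinuousWeak (F t))
    (h : H → ℝ) (hh_nonneg : ∀ x, 0 ≤ h x) (L_h : ℝ≥0) (hh_lip : LipschitzWith L_h h)
    (hF_bound : ∀ᵐ t ∂(volume.restrict (Icc 0 T)), ∀ x, Metric.infDist 0 (F t x) ≤ h x)
    (γ : ℝ) (hγ : 0 < γ)
    (hF_sel : ∃ f : ℝ → H → H, SweepingProcess.IsMeasurableSelection T F γ f)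
    (k : ℝ → ℝ) (hk_nonneg : ∀ t ∈ Icc 0 T, 0 ≤ k t) (hk_int : IntegrableOn k (Icc 0 T))
    (hF_mono : ∀ t ∈ Icc 0 T, ∀ x x' : H, ∀ y ∈ F t x, ∀ y' ∈ F t x',
      inner ℝ (y - y') (x - x') ≤ k t * ‖x - x'‖ ^ 2)
    -- the initial point
    (x₀ : H) (hx₀ : x₀ ∈ C 0) :
    ∃ x : ℝ → H,
      -- `x` is the unique solution
      SweepingProcess.IsSolution T C F x₀ x ∧
      (∀ y : ℝ → H, SweepingProcess.IsSolution T C F x₀ y → EqOn y x (Icc 0 T)) ∧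
      -- for every sequence of errors, the whole sequence of the algorithm converges to `x`,
      -- with a rate that is uniform in the selection and in the approximate projections
      ∀ ε : ℕ → ℝ, (∀ n, 1 ≤ n → 0 < ε n) →
        Tendsto (fun n => ε n / SweepingProcess.step T n ^ 2) atTop (𝓝 0) →
        ∃ D : ℝ, 0 ≤ D ∧
          ∀ (f : ℝ → H → H), SweepingProcess.IsMeasurableSelection T F γ f →
          ∀ (X : ℕ → ℕ → H) (xs : ℕ → ℝ → H),
            SweepingProcess.IsCatchingUp T C f ε x₀ X xs →
            TendstoUniformlyOn xs x atTop (Icc 0 T) ∧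
            ∀ n, 1 ≤ n → ∀ t ∈ Icc 0 T,
              ‖xs n t - x t‖ ^ 2 ≤
                D * (√(ε n) + SweepingProcess.step T n + √(ε n) / SweepingProcess.step T n) := by
  have hA : SweepingProcess.StandingAssumptions T (|L_C| + 1) ρ C F h L_h k :=
    { T_pos := hT
      L_nonneg := by positivity
      near := fun t ht s hs p hp =>
        SweepingProcess.exists_norm_sub_le_of_hausdorffEDist_le (S := C s) (S' := C t)
          (fun h0 => by rw [sub_eq_zero.1 (abs_eq_zero.1 h0)]) (abs_nonneg _)
          (by rw [Metric.hausdorffEDist_comm]; exact hC_lip t ht s hs) hp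
      nonempty := hC_nonempty
      prox := hC_prox
      F_closed := hF_closed
      F_convex := hF_convex
      F_usc := hF_usc
      h_nonneg := hh_nonneg
      h_lip := hh_lip
      F_bound := by
        filter_upwards [hF_bound, ae_restrict_mem measurableSet_Icc] with t hb ht x y hy
        exact SweepingProcess.norm_le_of_oneSidedLipschitz (hF_nonempty t ht) hh_lip hh_nonneg hb
          (hF_mono t ht) hy
      k_nonneg := hk_nonneg
      k_int := hk_int
      F_mono := hF_mono }
  obtain ⟨f₀, hf₀⟩ := hF_sel
  obtain ⟨x, hx⟩ := hA.exists_isSolution hf₀ hx₀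
  refine ⟨x, hx, fun y hy => hA.eqOn_of_isSolution hy hx, fun ε hε hlim => ?_⟩
  obtain ⟨D, hD0, hD⟩ := hA.exists_rate (γ := γ) hx₀ hx hε hlim
  refine ⟨D, hD0, fun f hf X xs hX => ⟨?_, hD f hf X xs hX⟩⟩
  refine SweepingProcess.tendstoUniformlyOn_of_rate ?_ (hD f hf X xs hX)
  obtain ⟨hq, hsq⟩ := SweepingProcess.tendsto_rate hε hT hlim
  simpa using ((hsq.add (SweepingProcess.tendsto_step T)).add hq).const_mul D
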